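/- \textbf{Setting (AO-RA-MN model).} Let $\mathcal M=(E,\mathcal I)$ be a finite matroid with $n=|E|$ elements and rank $r$. An adversary fixes an order $e_1,\dots,e_n$ of $E$ and a set $W$ of $n$ distinct non-negative weights; the weights are assigned to the elements by a uniformly random bijection $\omega:E\to W$. For $S\subseteq E$ let $w(S)=\sum_{e\in S}\omega(e)$, and let $\mathrm{OPT}(\omega)$ be an independent set of maximum weight. A randomized online algorithm knows only $n$ in advance. The elements arrive in the order $e_1,\dots,e_n$; when an element arrives, its weight is revealed, independence may be queried only for sets of elements that have already arrived, and the algorithm must irrevocably select or reject the element. All logarithms are to base $2$. A loop is an element $e$ with $\{e\}\notin\mathcal I$. \textbf{Algorithm 3 (with bound $L\ge 0$; run on a sequence of non-loop elements).} With probability $1/2$: select the first non-loop element of weight greater than $L$, if there is one, and nothing else. Otherwise: set $\mathrm{ALG}=\emptyset$, $r^*=2$, $w^*=L/2$. For each arriving element $e$: if $\omega(e)>w^*$ and $\mathrm{ALG}\cup\{e\}$ is independent, add $e$ to $\mathrm{ALG}$; then, if the rank of the set of elements of the sequence seen so far (including $e$) is at least $r^*$, set $w^*=L/(2r^*)$ with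 probability $1/\log(2r^*)$ (using fresh randomness), and in either case replace $r^*$ by $2r^*$. Return $\mathrm{ALG}$. \textbf{Algorithm 4.} Choose an integer $0\le b\le\lfloor\log n\rfloor$ uniformly at random ($b=0$ if $n=0$). Observe the first $2^b-1$ non-loop elements without selecting any, and let $L(b)$ be the largest weight among them ($L(0)=0$). Run Algorithm 3 with $L=L(b)$ on the next $2^b$ non-loop elements (or on as many of them as arrive), ignoring loops, and return its output $\mathrm{ALG}(\omega)$. \textbf{Theorem.} There is an absolute constant $C>0$ such that for every finite matroid $\mathcal M$ of rank $r$ on $n$ elements, every order of the elements and every set $W$ of $n$ distinct non-negative weights, the output $\mathrm{ALG}(\omega)$ of Algorithm 4 is always an independent set, and $$\mathbb E_\omega\big[w(\mathrm{OPT}(\omega))\big]\;\le\; C\,\log(2r)\,\log(2n)\;\mathbb E\big[w(\mathrm{ALG}(\omega))\big],$$ where the expectation on the right is over $\omega$ and the random choices of the algorithm (if $r=0$, both expectations are $0$ and $\log 0$ may be read as $0$). In particular, for $r\ge 2$, Algorithm 4 is an $O(\log r\log n)$-approximation in the AO-RA-MN model. -/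

import Mathlib

open scoped NNReal ENNReal

universe u

namespace MatroidSecretary

/-! ## Online selection on an unknown matroid whose size is known -/

/-- A randomized online algorithm for an unknown matroid on a known number of elements.
It is started with the number `n` of elements as its only information. Whenever an element `x`
arrives, `step` receives the current internal state, the restriction of the matroid to the elements
that have arrived so far (including `x`), the element `x` and its weight; using fresh randomness
it returns the next internal state and the irrevocable decision whether `x` is selected. -/
structure OnlineAlgorithm (α : Type u) where
  State : Type u
  init : ℕ → PMF State
  step : State → Matroid α → α → ℝ≥0 → PMF (State × Bool)

open scoped Classical in
/-- Feed the remaining elements of the input to the algorithm, one after the other.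
`arrived` is the set of elements that have already arrived, `selected` the set of elements that have
been selected among them. The result is the distribution of the final selected set. -/
noncomputable def OnlineAlgorithm.run {α : Type u} (A : OnlineAlgorithm α) (M : Matroid α)
    (ω : α → ℝ≥0) : Set α → Finset α → A.State → List α → PMF (Finset α)
  | _, selected, _, [] => PMF.pure selected
  | arrived, selected, s, x :: rest =>
      (A.step s (M.restrict (insert x arrived)) x (ω x)).bind fun out =>
        A.run M ω (insert x arrived) (if out.2 = true then insert x selected else selected)
          out.1 rest

/-- The distribution of the set `ALG(ω)` selected by the algorithm on the matroid `M` whose elements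
arrive in the order `order` and carry the weights `ω`. -/
noncomputable def OnlineAlgorithm.output {α : Type u} (A : OnlineAlgorithm α) (M : Matroid α)
    (ω : α → ℝ≥0) (order : List α) : PMF (Finset α) :=
  (A.init order.length).bind fun s => A.run M ω ∅ ∅ s order

/-! ## Weights, expectations and the optimum -/

/-- The expectation of a nonnegative function under a discrete distribution. -/
noncomputable def expect {β : Type u} (p : PMF β) (f : β → ℝ≥0∞) : ℝ≥0∞ :=
  ∑' b, p b * f b

/-- The weight `w(S)` of a finite set of elements. -/
noncomputable def weight {α : Type u} (ω : α → ℝ≥0) (S : Finset α) : ℝ≥0∞ :=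
  ∑ x ∈ S, (ω x : ℝ≥0∞)

/-- The weight `w(OPT(ω))` of a maximum-weight independent set of `M`. -/
noncomputable def optWeight {α : Type u} (M : Matroid α) (ω : α → ℝ≥0) : ℝ≥0∞ :=
  ⨆ S : {S : Finset α // M.Indep (S : Set α)}, weight ω S.1

open scoped Classical in
/-- The weight function of a bijection from the ground set `E` onto a set `W` of weights
(the value off the ground set is irrelevant). -/
noncomputable def assign {α : Type u} {E : Set α} {W : Finset ℝ≥0} (ω : E ≃ W) : α → ℝ≥0 :=
  fun x => if h : x ∈ E then (ω ⟨x, h⟩ : ℝ≥0) else 0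

/-- The expectation of `f` over a uniformly random bijection from `E` onto `W`. -/
noncomputable def averageAssignment {α : Type u} (E : Set α) (W : Finset ℝ≥0)
    (f : (α → ℝ≥0) → ℝ≥0∞) : ℝ≥0∞ :=
  (∑' ω : E ≃ W, f (assign ω)) / (Nat.card (E ≃ W) : ℝ≥0∞)

/-! ## The thresholding algorithm with a given bound `L` -/

/-- A coin that shows `true` with probability `p`. -/
noncomputable def coin (p : ℝ≥0) (hp : p ≤ 1) : PMF Bool :=
  PMF.ofFintype (fun b => if b = true then (p : ℝ≥0∞) else 1 - (p : ℝ≥0∞)) (by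
    have h : (p : ℝ≥0∞) ≤ 1 := by exact_mod_cast hp
    simp [h])

/-- The internal state of the thresholding algorithm: the bound `L`, whether the algorithm
just picks one element with weight above `L`, the elements it has seen, the set `ALG` it
has chosen, the rank guess `r*` and the threshold `w*`. -/
structure ThresholdState (α : Type u) where
  bound : ℝ≥0
  pickOne : Bool
  seen : Finset α
  chosen : Finset α
  rStar : ℕ
  wStar : ℝ≥0

/-- Start of the thresholding algorithm: with probability `1/2` it decides to pick just one
non-loop element above `L`; `ALG = ∅`, `r* = 2` and `w* = L / 2`. -/
noncomputable def thresholdInit (α : Type u) (L : ℝ≥0) : PMF (ThresholdState α) :=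
  (coin (1 / 2) (by norm_num)).bind fun c =>
    PMF.pure { bound := L, pickOne := c, seen := ∅, chosen := ∅, rStar := 2, wStar := L / 2 }

open scoped Classical in
/-- The thresholding algorithm on the arrival of `x` with weight `v`.
In the single-element mode the first non-loop element of weight above `L` is picked.
Otherwise `x` is added to `ALG` if its weight is above `w*` and `ALG ∪ {x}` is independent; then, if
the rank of the elements seen (including `x`) is at least `r*`, the threshold is set to `L / (2 r*)`
with probability `1 / log (2 r*)`, and `r*` is doubled. Logarithms are to base two; `r*` is always
a power of two, so `Nat.log 2 (2 * r*)` is the exact logarithm. -/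
noncomputable def thresholdStep {α : Type u} (s : ThresholdState α) (M : Matroid α) (x : α)
    (v : ℝ≥0) : PMF (ThresholdState α × Bool) :=
  if s.pickOne = true then
    if s.chosen = ∅ ∧ M.IsNonloop x ∧ s.bound < v then
      PMF.pure ({ s with seen := insert x s.seen, chosen := {x} }, true)
    else
      PMF.pure ({ s with seen := insert x s.seen }, false)
  else
    let accept : Bool := decide (s.wStar < v ∧ M.Indep (insert x s.chosen : Finset α))
    let s' : ThresholdState α :=
      { s with
        seen := insert x s.seen
        chosen := if accept = true then insert x s.chosen else s.chosen }
    if (s.rStar : ℕ∞) ≤ M.eRk (s'.seen : Set α) then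
      (coin ((Nat.log 2 (2 * s.rStar) : ℝ≥0)⁻¹) (Nat.cast_inv_le_one _)).bind fun c =>
        PMF.pure
          ({ s' with
              rStar := 2 * s.rStar
              wStar := if c = true then s.bound / (2 * (s.rStar : ℝ≥0)) else s.wStar }, accept)
    else
      PMF.pure (s', accept)

/-! ## The random block algorithm -/

/-- The internal state of the random block algorithm.
`observe b c L`: the block number is `b`, and `c` non-loop elements have been observed so far,
the largest weight among them being `L` (`L = 0` if `c = 0`).
`block k s`: the thresholding algorithm is running on the block and is in the state `s`; there are
`k` elements of the block still to come. -/
inductive BlockState (α : Type u) where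
  | observe (b c : ℕ) (L : ℝ≥0) : BlockState α
  | block (k : ℕ) (s : ThresholdState α) : BlockState α

open scoped Classical in
/-- The random block algorithm on the arrival of `x` with weight `v`. Loops are ignored,
the first `2 ^ b - 1` non-loop elements are only observed, the thresholding algorithm is run on the
next `2 ^ b` non-loop elements, and everything after them is rejected. -/
noncomputable def blockStep {α : Type u} (s : BlockState α) (M : Matroid α) (x : α)
    (v : ℝ≥0) : PMF (BlockState α × Bool) :=
  if M.IsNonloop x then
    match s with
    | .observe b c L =>
        if c < 2 ^ b - 1 then
          PMF.pure (.observe b (c + 1) (max L v), false)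
        else
          (thresholdInit α L).bind fun t =>
            (thresholdStep t M x v).bind fun out =>
              PMF.pure (.block (2 ^ b - 1) out.1, out.2)
    | .block 0 t => PMF.pure (.block 0 t, false)
    | .block (k + 1) t =>
        (thresholdStep t M x v).bind fun out => PMF.pure (.block k out.1, out.2)
  else
    PMF.pure (s, false)

/-- The random block algorithm: knowing `n`, it chooses an integer `0 ≤ b ≤ log₂ n` uniformly at
random, and then proceeds as described in `blockStep`. -/
noncomputable def blockAlgorithm (α : Type u) : OnlineAlgorithm α where
  State := BlockState α
  init n := (PMF.uniformOfFintype (Fin (Nat.log 2 n + 1))).bind fun b =>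
    PMF.pure (.observe b 0 0)
  step := blockStep

end MatroidSecretary

/-! Cut the non-loop elements into blocks of sizes 1, 2, 4, …; about `log n` blocks cover
everything, and a uniformly random one is played with bound `L`, the largest weight before it. The
optimum splits over the blocks, so it suffices to bound its share of block `b` by `O(log r)` times
the expected gain on blocks `b` and `b - 1`.

Fix the weights. Elements of the block heavier than `L` are charged to `recordWeight`. Lighter ones
are rounded down to the levels `L / 2 ^ l`, with `N` levels for a block of rank about `2 ^ N`. The
coins of the algorithm are reservoir sampling over the levels reached so far, so the threshold ends
up uniform on them. Greedy selection at level `l` recovers the rank of the elements above `L / 2 ^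
l`, except for the rank at most `2 ^ (l - 1)` already seen when the level opens; this loss costs at
most `L` per level (`le_mul_thresholdValue`, `weight_inter_le`).

Randomness of the weights pays for `L` and for the records. By exchangeability, records cost at most
`2 * E[L]` (`average_recordWeight_le`). And `E[L]` is a constant times the gain of single-element
mode on the preceding block: with constant probability the maximum up to the end of that block lies
in the block while the runner-up lies before it, and then the maximum is picked (`average_sup_le`,
`sum_topPairWeight_le_thresholdValue`). -/

namespace MatroidSecretary

/-! ### Expectations under discrete distributions. -/

section Expectation

variable {β γ : Type*}

theorem expect_pure (b : β) (f : β → ℝ≥0∞) : expect (PMF.pure b) f = f b := by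
  rw [expect, tsum_eq_single b]
  · simp
  · intro c hc
    simp [PMF.pure_apply, hc]

theorem expect_bind (p : PMF β) (q : β → PMF γ) (f : γ → ℝ≥0∞) :
    expect (p.bind q) f = expect p fun b => expect (q b) f := by
  simp only [expect, PMF.bind_apply, ← ENNReal.tsum_mul_right, ← ENNReal.tsum_mul_left]
  rw [ENNReal.tsum_comm]
  simp only [mul_assoc]

theorem expect_congr {p : PMF β} {f g : β → ℝ≥0∞} (h : ∀ b ∈ p.support, f b = g b) :
    expect p f = expect p g := by
  refine tsum_congr fun b => ?_
  by_cases hb : b ∈ p.support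
  · rw [h b hb]
  · rw [PMF.apply_eq_zero_iff p b |>.2 hb, zero_mul, zero_mul]

theorem expect_const (p : PMF β) (c : ℝ≥0∞) : expect p (fun _ => c) = c := by
  rw [expect, ENNReal.tsum_mul_right, p.tsum_coe, one_mul]

theorem expect_coin (p : ℝ≥0) (hp : p ≤ 1) (f : Bool → ℝ≥0∞) :
    expect (coin p hp) f = p * f true + (1 - p) * f false := by
  rw [expect, tsum_fintype]
  simp [coin]

theorem expect_uniformOfFintype [Fintype β] [Nonempty β] (f : β → ℝ≥0∞) :
    expect (PMF.uniformOfFintype β) f = (Fintype.card β : ℝ≥0∞)⁻¹ * ∑ b, f b := by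
  rw [expect, tsum_fintype, Finset.mul_sum]
  simp

end Expectation

/-! ### From the online run to the thresholding procedure on one block; independence of the output.
-/

section Threshold

open scoped Classical

variable {α : Type u} {M : Matroid α} {s : ThresholdState α} {x : α} {v : ℝ≥0}

theorem thresholdStep_spec {out : ThresholdState α × Bool}
    (h : out ∈ (thresholdStep s M x v).support) :
    out.1.seen = insert x s.seen ∧
      out.1.chosen = (if out.2 = true then insert x s.chosen else s.chosen) ∧
      (out.1.chosen = s.chosen ∨ M.Indep (out.1.chosen : Set α)) := by
  simp only [thresholdStep] at h
  split_ifs at h with h₁ h₂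
  · rw [PMF.mem_support_pure_iff] at h
    subst h
    simp [h₂.1, h₂.2.1]
  · rw [PMF.mem_support_pure_iff] at h
    subst h
    simp
  all_goals
    simp only [PMF.mem_support_bind_iff, PMF.mem_support_pure_iff] at h
  · obtain ⟨c, -, rfl⟩ := h
    simp_all
  · obtain ⟨c, -, rfl⟩ := h
    simp_all
  · subst h
    simp_all
  · subst h
    simp_all

/-- Every matroid query of the step concerns a set inside `R`, so the analysis may use `M` itself in
place of its restriction to the arrived elements. -/
theorem thresholdStep_restrict {R : Set α} (hx : x ∈ R) (hs : (s.seen : Set α) ⊆ R)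
    (hc : (s.chosen : Set α) ⊆ R) :
    thresholdStep s (M.restrict R) x v = thresholdStep s M x v := by
  have h₁ : (M.restrict R).IsNonloop x ↔ M.IsNonloop x := by
    simp [Matroid.restrict_isNonloop_iff, hx]
  have h₂ : (M.restrict R).Indep ((insert x s.chosen : Finset α) : Set α) ↔
      M.Indep ((insert x s.chosen : Finset α) : Set α) := by
    rw [Matroid.restrict_indep_iff, and_iff_left]
    rw [Finset.coe_insert]
    exact Set.insert_subset hx hc
  have h₃ : (M.restrict R).eRk ((insert x s.seen : Finset α) : Set α) =
      M.eRk ((insert x s.seen : Finset α) : Set α) := by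
    refine M.restrict_eRk_eq ?_
    rw [Finset.coe_insert]
    exact Set.insert_subset hx hs
  unfold thresholdStep
  simp only [h₁, h₂, h₃]

/-- The expected weight which the thresholding algorithm has selected after it was run on a list of
elements, starting in a given state. -/
noncomputable def thresholdValue (M : Matroid α) (ω : α → ℝ≥0) :
    ThresholdState α → List α → ℝ≥0∞
  | s, [] => weight ω s.chosen
  | s, x :: rest => expect (thresholdStep s M x (ω x)) fun out => thresholdValue M ω out.1 rest

/-- The run of the random block algorithm on the remaining elements. -/
noncomputable def blockRun (M : Matroid α) (ω : α → ℝ≥0) (arrived : Set α) (sel : Finset α)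
    (s : BlockState α) (rest : List α) : PMF (Finset α) :=
  (blockAlgorithm α).run M ω arrived sel s rest

theorem blockRun_nil (M : Matroid α) (ω : α → ℝ≥0) (arrived : Set α) (sel : Finset α)
    (s : BlockState α) : blockRun M ω arrived sel s [] = PMF.pure sel := rfl

theorem blockRun_cons (M : Matroid α) (ω : α → ℝ≥0) (arrived : Set α) (sel : Finset α)
    (s : BlockState α) (x : α) (rest : List α) :
    blockRun M ω arrived sel s (x :: rest) =
      (blockStep s (M.restrict (insert x arrived)) x (ω x)).bind fun out =>
        blockRun M ω (insert x arrived) (if out.2 = true then insert x sel else sel)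
          out.1 rest := rfl

theorem output_blockAlgorithm (M : Matroid α) (ω : α → ℝ≥0) (order : List α) :
    (blockAlgorithm α).output M ω order =
      (PMF.uniformOfFintype (Fin (Nat.log 2 order.length + 1))).bind fun b =>
        blockRun M ω ∅ ∅ (.observe b 0 0) order := by
  change PMF.bind (PMF.bind _ fun b : Fin (Nat.log 2 order.length + 1) =>
    PMF.pure (BlockState.observe (b : ℕ) 0 0)) (fun s => blockRun M ω ∅ ∅ s order) = _
  rw [PMF.bind_bind]
  congr 1
  funext b
  exact PMF.pure_bind _ _

/-- The selected set stays equal to `chosen`, loops change nothing, and after `k` non-loops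
everything is rejected. -/
theorem expect_run_block (M : Matroid α) (ω : α → ℝ≥0) (rest : List α) :
    ∀ (arrived : Set α) (k : ℕ) (s : ThresholdState α),
      (s.seen : Set α) ⊆ arrived → (s.chosen : Set α) ⊆ arrived →
      expect (blockRun M ω arrived s.chosen (.block k s) rest) (weight ω) =
        thresholdValue M ω s ((rest.filter (M.IsNonloop ·)).take k) := by
  induction rest with
  | nil =>
    intro arrived k s _ _
    simp only [blockRun_nil, expect_pure, List.filter_nil, List.take_nil, thresholdValue]
  | cons x rest ih =>
    intro arrived k s hs hc
    have hs' : (s.seen : Set α) ⊆ insert x arrived := hs.trans (Set.subset_insert _ _)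
    have hc' : (s.chosen : Set α) ⊆ insert x arrived := hc.trans (Set.subset_insert _ _)
    simp only [blockRun_cons, expect_bind]
    by_cases hx : M.IsNonloop x
    · have hx' : (M.restrict (insert x arrived)).IsNonloop x := by
        simp [Matroid.restrict_isNonloop_iff, hx]
      simp only [blockStep, hx', if_true]
      cases k with
      | zero =>
        simp only [expect_pure, Bool.false_eq_true, if_false, List.take_zero]
        rw [ih _ 0 s hs' hc', List.take_zero]
      | succ k =>
        simp only [hx, decide_true, List.filter_cons_of_pos, List.take_succ_cons, thresholdValue,
          expect_bind, expect_pure, thresholdStep_restrict (Set.mem_insert x arrived) hs' hc']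
        refine expect_congr fun out hout => ?_
        obtain ⟨h₁, h₂, -⟩ := thresholdStep_spec hout
        rw [← h₂]
        apply ih
        · rw [h₁, Finset.coe_insert]
          exact Set.insert_subset_insert hs
        · rw [h₂]
          split_ifs
          · rw [Finset.coe_insert]
            exact Set.insert_subset_insert hc
          · exact hc'
    · have hx' : ¬ (M.restrict (insert x arrived)).IsNonloop x := by
        simp [Matroid.restrict_isNonloop_iff, hx]
      simp only [blockStep, hx', if_false, expect_pure, Bool.false_eq_true]
      rw [ih _ k s hs' hc', List.filter_cons_of_neg (by simpa using hx)]

theorem expect_run_observe (M : Matroid α) (ω : α → ℝ≥0) (b : ℕ) (rest : List α) :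
    ∀ (arrived : Set α) (c : ℕ) (L : ℝ≥0), c ≤ 2 ^ b - 1 →
      expect (blockRun M ω arrived ∅ (.observe b c L) rest) (weight ω) =
        expect (thresholdInit α
            (L ⊔ ((rest.filter (M.IsNonloop ·)).take (2 ^ b - 1 - c)).toFinset.sup ω))
          fun t => thresholdValue M ω t
            (((rest.filter (M.IsNonloop ·)).drop (2 ^ b - 1 - c)).take (2 ^ b)) := by
  induction rest with
  | nil =>
    intro arrived c L _
    -- The input ended before the block began: both sides are the weight of `∅`, whatever the
    -- initial coin shows.
    simp only [blockRun_nil, expect_pure, List.filter_nil, List.take_nil, List.drop_nil,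
      thresholdValue, thresholdInit, expect_bind, expect_const]
  | cons x rest ih =>
    intro arrived c L hc
    simp only [blockRun_cons, expect_bind]
    by_cases hx : M.IsNonloop x
    · have hx' : (M.restrict (insert x arrived)).IsNonloop x := by
        simp [Matroid.restrict_isNonloop_iff, hx]
      simp only [blockStep, hx', if_true, hx, decide_true, List.filter_cons_of_pos]
      by_cases hcb : c < 2 ^ b - 1
      · obtain ⟨d, hd⟩ : ∃ d, 2 ^ b - 1 - c = d + 1 := ⟨2 ^ b - 1 - c - 1, by omega⟩
        have hd' : 2 ^ b - 1 - (c + 1) = d := by omega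
        rw [if_pos hcb, expect_pure]
        simp only [Bool.false_eq_true, if_false]
        rw [ih _ (c + 1) (max L (ω x)) (by omega), hd, hd', List.take_succ_cons,
          List.drop_succ_cons, List.toFinset_cons, Finset.sup_insert, sup_assoc]
      -- The initial coin of the thresholding algorithm is tossed only when the first block element
      -- arrives, and that element is the first of the `2 ^ b`.
      · have hd : 2 ^ b - 1 - c = 0 := by omega
        obtain ⟨k, hk⟩ : ∃ k, 2 ^ b = k + 1 := ⟨2 ^ b - 1, by have := Nat.two_pow_pos b; omega⟩
        rw [if_neg hcb, hd]
        simp only [List.take_zero, List.toFinset_nil, Finset.sup_empty, sup_bot_eq, List.drop_zero,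
          hk, List.take_succ_cons, add_tsub_cancel_right]
        simp only [thresholdInit, expect_bind, expect_pure, thresholdValue]
        refine expect_congr fun coin _ => ?_
        rw [thresholdStep_restrict (Set.mem_insert x arrived) (by simp) (by simp)]
        refine expect_congr fun out hout => ?_
        obtain ⟨h₁, h₂, -⟩ := thresholdStep_spec hout
        simp only at h₂
        rw [← h₂]
        apply expect_run_block
        · rw [h₁, Finset.coe_insert]
          exact Set.insert_subset_insert (by simp)
        · rw [h₂]
          split_ifs
          · rw [Finset.coe_insert]
            exact Set.insert_subset_insert (by simp)
          · simp
    · have hx' : ¬ (M.restrict (insert x arrived)).IsNonloop x := by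
        simp [Matroid.restrict_isNonloop_iff, hx]
      simp only [blockStep, hx', if_false, expect_pure, Bool.false_eq_true]
      rw [ih _ c L hc, List.filter_cons_of_neg (by simpa using hx)]

/-- Induction needs the state to agree with `sel`: equality with `chosen` inside the block, and `∅`
while observing. -/
theorem indep_of_mem_support_run (M : Matroid α) (ω : α → ℝ≥0) (rest : List α) :
    ∀ (arrived : Set α) (sel : Finset α) (s : BlockState α),
      M.Indep (sel : Set α) → (∀ k t, s = .block k t → t.chosen = sel) →
      (∀ b c L, s = .observe b c L → sel = ∅) →
      ∀ S ∈ (blockRun M ω arrived sel s rest).support, M.Indep (S : Set α) := by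
  induction rest with
  | nil =>
    intro arrived sel s hsel _ _ S hS
    rw [blockRun_nil, PMF.mem_support_pure_iff] at hS
    rwa [hS]
  | cons x rest ih =>
    intro arrived sel s hsel hb ho S hS
    rw [blockRun_cons, PMF.mem_support_bind_iff] at hS
    obtain ⟨out, hout, hS⟩ := hS
    have key : ∀ (t : ThresholdState α) (o : ThresholdState α × Bool) (k : ℕ), t.chosen = sel →
        o ∈ (thresholdStep t (M.restrict (insert x arrived)) x (ω x)).support →
        out = (.block k o.1, o.2) → M.Indep (S : Set α) := by
      intro t o k ht hoo hout'
      obtain ⟨-, h₂, h₃⟩ := thresholdStep_spec hoo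
      subst hout'
      rw [ht] at h₂ h₃
      refine ih _ _ _ ?_ ?_ ?_ S hS
      · simp only [← h₂]
        rcases h₃ with h₃ | h₃
        · rwa [h₃]
        · exact (Matroid.restrict_indep_iff.1 h₃).1
      · rintro k' t' h
        simp only [BlockState.block.injEq] at h
        rw [← h.2]
        exact h₂
      · rintro _ _ _ h
        cases h
    have same : out = (s, false) → M.Indep (S : Set α) := by
      rintro rfl
      exact ih _ _ _ hsel hb ho S hS
    unfold blockStep at hout
    split_ifs at hout with hx
    · cases s with
      | observe b c L =>
        have hsel0 := ho b c L rfl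
        subst hsel0
        simp only at hout
        split_ifs at hout with hc
        · rw [PMF.mem_support_pure_iff] at hout
          subst hout
          refine ih _ _ _ (by simp) ?_ ?_ S hS
          · rintro _ _ h
            cases h
          · simp
        · rw [PMF.mem_support_bind_iff] at hout
          obtain ⟨t, ht, hout⟩ := hout
          rw [PMF.mem_support_bind_iff] at hout
          obtain ⟨o, ho', hout⟩ := hout
          rw [PMF.mem_support_pure_iff] at hout
          rw [thresholdInit, PMF.mem_support_bind_iff] at ht
          obtain ⟨c', -, ht⟩ := ht
          rw [PMF.mem_support_pure_iff] at ht
          exact key t o _ (by rw [ht]) ho' hout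
      | block k t =>
        cases k with
        | zero =>
          simp only [PMF.mem_support_pure_iff] at hout
          exact same hout
        | succ k =>
          simp only [PMF.mem_support_bind_iff, PMF.mem_support_pure_iff] at hout
          obtain ⟨o, ho', hout⟩ := hout
          exact key t o _ (hb _ _ rfl) ho' hout
    · rw [PMF.mem_support_pure_iff] at hout
      exact same hout

theorem indep_of_mem_support_output (M : Matroid α) (ω : α → ℝ≥0) (order : List α)
    (S : Finset α) (hS : S ∈ ((blockAlgorithm α).output M ω order).support) :
    M.Indep (S : Set α) := by
  rw [output_blockAlgorithm, PMF.mem_support_bind_iff] at hS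
  obtain ⟨b, -, hS⟩ := hS
  refine indep_of_mem_support_run M ω order ∅ ∅ _ (by simp) ?_ (by simp) S hS
  rintro _ _ h
  cases h

end Threshold

/-! ### Integer-valued rank. -/

section Rank

variable {α : Type u} {M : Matroid α}

/-- The rank of a set as a natural number. -/
noncomputable def rk (M : Matroid α) (X : Set α) : ℕ := (M.eRk X).toNat

theorem coe_rk [M.RankFinite] (X : Set α) : (rk M X : ℕ∞) = M.eRk X :=
  ENat.natCast_toNat (Matroid.eRk_ne_top_iff.2 (M.isRkFinite_set X))

theorem rk_mono [M.RankFinite] {X Y : Set α} (h : X ⊆ Y) : rk M X ≤ rk M Y := by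
  have := M.eRk_mono h
  rw [← coe_rk, ← coe_rk] at this
  exact_mod_cast this

theorem rk_union_le [M.RankFinite] (X Y : Set α) : rk M (X ∪ Y) ≤ rk M X + rk M Y := by
  have := M.eRk_union_le_eRk_add_eRk X Y
  rw [← coe_rk, ← coe_rk, ← coe_rk] at this
  exact_mod_cast this

theorem rk_insert_le [M.RankFinite] (x : α) (X : Set α) : rk M (insert x X) ≤ rk M X + 1 := by
  have := M.eRk_insert_le_add_one x X
  rw [← coe_rk, ← coe_rk] at this
  exact_mod_cast this

theorem rk_empty : rk M ∅ = 0 := by simp [rk]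

theorem rk_eq_card {S : Finset α} (hS : M.Indep (S : Set α)) : rk M (S : Set α) = S.card := by
  rw [rk, hS.eRk_eq_encard, Set.encard_coe_eq_coe_finsetCard, ENat.toNat_natCast]

/-- An element `x` of the ground set that cannot extend `C` lies in the closure of `C`, hence in
that of `X`. -/
theorem rk_insert_of_not_indep {C X : Set α} {x : α} (hC : M.Indep C) (hx : ¬ M.Indep (insert x C))
    (hCX : C ⊆ X) : rk M (insert x X) = rk M X := by
  by_cases hxE : x ∈ M.E
  · have hcl : x ∈ M.closure C := by
      by_contra h
      exact hx (hC.insert_indep_iff.2 (Or.inl ⟨hxE, h⟩))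
    rw [rk, ← M.eRk_insert_closure_eq, Set.insert_eq_of_mem (M.closure_subset_closure hCX hcl),
      M.eRk_closure_eq, rk]
  · rw [rk, M.eRk_insert_of_notMem_ground X hxE, rk]

end Rank

/-! ### The single-element mode. -/

section PickOne

open scoped Classical

variable {α : Type u} {M : Matroid α} {ω : α → ℝ≥0}

theorem thresholdValue_pickOne_of_nonempty (l : List α) :
    ∀ s : ThresholdState α, s.pickOne = true → s.chosen ≠ ∅ →
      thresholdValue M ω s l = weight ω s.chosen := by
  induction l with
  | nil => intros; rfl
  | cons x l ih =>
    intro s hs hc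
    rw [thresholdValue, thresholdStep, if_pos hs, if_neg (fun h => hc h.1), expect_pure]
    exact ih { s with seen := insert x s.seen } hs hc

/-- Since `e` is the only element above the bound, nothing arriving earlier can take its place. -/
theorem le_thresholdValue_pickOne {e : α} (l : List α) :
    ∀ s : ThresholdState α, s.pickOne = true → s.chosen = ∅ → (∀ x ∈ l, M.IsNonloop x) →
      e ∈ l → s.bound < ω e → (∀ y ∈ l, y ≠ e → ω y ≤ s.bound) →
      (ω e : ℝ≥0∞) ≤ thresholdValue M ω s l := by
  induction l with
  | nil => intro s _ _ _ he; simp at he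
  | cons x l ih =>
    intro s hs hc hl he hbe hy
    rw [thresholdValue, thresholdStep, if_pos hs]
    by_cases hxe : x = e
    · subst hxe
      rw [if_pos ⟨hc, hl x List.mem_cons_self, hbe⟩, expect_pure]
      rw [thresholdValue_pickOne_of_nonempty l
        { s with seen := insert x s.seen, chosen := {x} } hs (Finset.singleton_ne_empty x)]
      simp [weight]
    · rw [if_neg (fun h => (hy x List.mem_cons_self hxe).not_gt h.2.2), expect_pure]
      refine ih { s with seen := insert x s.seen } hs hc
        (fun y h => hl y (List.mem_cons_of_mem _ h)) ?_ hbe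
        (fun y h => hy y (List.mem_cons_of_mem _ h))
      exact (List.mem_cons.1 he).resolve_left (Ne.symm hxe)

end PickOne

/-! ### The randomly decreasing threshold. -/

section RandomThreshold

open scoped Classical

variable {α : Type u} {M : Matroid α} {ω : α → ℝ≥0}

/-- The selected set after `x` has been offered to the thresholding algorithm with threshold
`θ`. -/
noncomputable def offer (M : Matroid α) (ω : α → ℝ≥0) (θ : ℝ≥0) (C : Finset α) (x : α) : Finset α :=
  if θ < ω x ∧ M.Indep (insert x C : Finset α) then insert x C else C

theorem offer_indep {θ : ℝ≥0} {C : Finset α} {x : α} (hC : M.Indep (C : Set α)) :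
    M.Indep (offer M ω θ C x : Set α) := by
  unfold offer
  split_ifs with h
  · exact h.2
  · exact hC

theorem lt_of_mem_offer {θ : ℝ≥0} {C : Finset α} {x y : α} (hC : ∀ y ∈ C, θ < ω y)
    (hy : y ∈ offer M ω θ C x) : θ < ω y := by
  unfold offer at hy
  split_ifs at hy with h
  · rcases Finset.mem_insert.1 hy with rfl | hy
    · exact h.1
    · exact hC y hy
  · exact hC y hy

/-- The greedy invariant: the rank still attainable at threshold `θ` never drops. An accepted
element moves into `C`, one rejected for dependence adds no rank over `C`, and a light one was not
counted. -/
theorem rk_union_cons_le_offer [M.RankFinite] {θ : ℝ≥0} {C : Finset α} {x : α} {l : List α}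
    (hC : M.Indep (C : Set α)) :
    rk M ((C : Set α) ∪ {y | y ∈ x :: l ∧ θ < ω y}) ≤
      rk M ((offer M ω θ C x : Set α) ∪ {y | y ∈ l ∧ θ < ω y}) := by
  by_cases hx : θ < ω x
  · have hset : (C : Set α) ∪ {y | y ∈ x :: l ∧ θ < ω y} =
        insert x ((C : Set α) ∪ {y | y ∈ l ∧ θ < ω y}) := by
      ext y
      by_cases hyx : y = x
      · subst hyx; simp [hx]
      · simp [hyx]
    by_cases hi : M.Indep (insert x C : Finset α)
    · rw [hset, offer, if_pos ⟨hx, hi⟩, Finset.coe_insert, Set.insert_union]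
    · rw [hset, offer, if_neg (fun h => hi h.2)]
      rw [Finset.coe_insert] at hi
      rw [rk_insert_of_not_indep hC hi Set.subset_union_left]
  · rw [offer, if_neg (fun h => hx h.1)]
    refine rk_mono ?_
    rintro y (hy | ⟨hy, hθ⟩)
    · exact Or.inl hy
    · refine Or.inr ⟨?_, hθ⟩
      rcases List.mem_cons.1 hy with rfl | hy
      · exact absurd hθ hx
      · exact hy

theorem thresholdValue_cons_of_lt {s : ThresholdState α} {x : α} {l : List α}
    (hs : s.pickOne = false) (hr : ¬ (s.rStar : ℕ∞) ≤ M.eRk (insert x s.seen : Finset α)) :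
    thresholdValue M ω s (x :: l) =
      thresholdValue M ω { s with
        seen := insert x s.seen, chosen := offer M ω s.wStar s.chosen x } l := by
  rw [thresholdValue, thresholdStep, if_neg (by simp [hs])]
  simp only [hr, if_false, expect_pure, offer, decide_eq_true_eq]

theorem thresholdValue_cons_of_le {s : ThresholdState α} {x : α} {l : List α}
    (hs : s.pickOne = false) (hr : (s.rStar : ℕ∞) ≤ M.eRk (insert x s.seen : Finset α)) :
    thresholdValue M ω s (x :: l) =
      (((Nat.log 2 (2 * s.rStar) : ℝ≥0)⁻¹ : ℝ≥0) : ℝ≥0∞) * thresholdValue M ω { s with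
        seen := insert x s.seen, chosen := offer M ω s.wStar s.chosen x, rStar := 2 * s.rStar,
        wStar := s.bound / (2 * (s.rStar : ℝ≥0)) } l +
      (1 - (((Nat.log 2 (2 * s.rStar) : ℝ≥0)⁻¹ : ℝ≥0) : ℝ≥0∞)) * thresholdValue M ω { s with
        seen := insert x s.seen, chosen := offer M ω s.wStar s.chosen x, rStar := 2 * s.rStar } l := by
  rw [thresholdValue, thresholdStep, if_neg (by simp [hs])]
  simp only [hr, if_true, expect_bind, expect_pure, expect_coin, offer, decide_eq_true_eq,
    Bool.false_eq_true, if_false]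

/-- The reservoir-sampling identity. With `p = 1 / (j + 1)` one has `p * (j + 1) = 1` and `(1 - p) *
(j + 1) = j`, so the switching branch contributes one copy of `A` and the staying branch `j` copies
of `B`. -/
theorem le_mul_coin_mixture {j : ℕ} {N A B S V₁ V₂ : ℝ≥0∞}
    (h₁ : ((j + 1 : ℕ) : ℝ≥0∞) * A + S ≤ N * V₁)
    (h₂ : ((j + 1 : ℕ) : ℝ≥0∞) * B + S ≤ N * V₂) :
    j * B + (A + S) ≤
      N * (((((j + 1 : ℕ) : ℝ≥0)⁻¹ : ℝ≥0) : ℝ≥0∞) * V₁ +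
        (1 - ((((j + 1 : ℕ) : ℝ≥0)⁻¹ : ℝ≥0) : ℝ≥0∞)) * V₂) := by
  have hne : ((j + 1 : ℕ) : ℝ≥0) ≠ 0 := by positivity
  set p : ℝ≥0 := ((j + 1 : ℕ) : ℝ≥0)⁻¹ with hp
  have hp1 : p ≤ 1 := Nat.cast_inv_le_one _
  have e₁ : (p : ℝ≥0∞) * ((j + 1 : ℕ) : ℝ≥0∞) = 1 := by
    have : p * ((j + 1 : ℕ) : ℝ≥0) = 1 := inv_mul_cancel₀ hne
    exact_mod_cast congrArg ((↑) : ℝ≥0 → ℝ≥0∞) this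
  have e₂ : (1 - (p : ℝ≥0∞)) * ((j + 1 : ℕ) : ℝ≥0∞) = j := by
    rw [ENNReal.sub_mul (fun _ _ => ENNReal.natCast_ne_top _), e₁, one_mul]
    push_cast
    exact ENNReal.add_sub_cancel_right ENNReal.one_ne_top
  have e₃ : (p : ℝ≥0∞) + (1 - (p : ℝ≥0∞)) = 1 := add_tsub_cancel_of_le (by exact_mod_cast hp1)
  calc j * B + (A + S) = ((p : ℝ≥0∞) * ((j + 1 : ℕ) : ℝ≥0∞)) * A +
        ((1 - (p : ℝ≥0∞)) * ((j + 1 : ℕ) : ℝ≥0∞)) * B + ((p : ℝ≥0∞) + (1 - (p : ℝ≥0∞))) * S := by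
        rw [e₁, e₂, e₃]; ring
    _ = p * (((j + 1 : ℕ) : ℝ≥0∞) * A + S) + (1 - p) * (((j + 1 : ℕ) : ℝ≥0∞) * B + S) := by ring
    _ ≤ p * (N * V₁) + (1 - p) * (N * V₂) := by gcongr
    _ = _ := by ring

/-- The elements of `T` of weight above `L / 2 ^ l`. -/
def heavy (ω : α → ℝ≥0) (L : ℝ≥0) (T : Finset α) (l : ℕ) : Set α :=
  {x | x ∈ T ∧ L / 2 ^ l < ω x}

/-- A potential argument. Here `j` levels have been opened and level `i` is in force; the current
level is credited `j` times, standing for the `j` equally likely levels. Each unopened level `l` is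
credited with its heavy rank less the `2 ^ (l - 1)` that may have passed by then (truncated at `0`).
The disjunction on `j` ensures that at the end `j` is exactly the number of levels of `T`. -/
theorem le_mul_thresholdValue [M.RankFinite] (L : ℝ≥0) (T : Finset α) (rest : List α) :
    ∀ (s : ThresholdState α) (i j : ℕ), s.pickOne = false → s.bound = L → s.rStar = 2 ^ j →
      s.wStar = L / 2 ^ i → i ≤ j → (∀ x ∈ s.chosen, L / 2 ^ i < ω x) →
      M.Indep (s.chosen : Set α) → T = s.seen ∪ rest.toFinset → rk M (s.seen : Set α) < 2 ^ j →
      (j = 1 ∨ (1 ≤ j ∧ 2 ^ (j - 1) ≤ rk M (s.seen : Set α))) →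
      (j : ℝ≥0∞) * ((L / 2 ^ i : ℝ≥0) *
          (rk M ((s.chosen : Set α) ∪ {x | x ∈ rest ∧ L / 2 ^ i < ω x}) : ℝ≥0∞)) +
        ∑ l ∈ Finset.Ico (j + 1) (Nat.log 2 (rk M (T : Set α)) + 2),
          ((L / 2 ^ l : ℝ≥0) : ℝ≥0∞) * ((rk M (heavy ω L T l) - 2 ^ (l - 1) : ℕ) : ℝ≥0∞) ≤
      ((Nat.log 2 (rk M (T : Set α)) + 1 : ℕ) : ℝ≥0∞) * thresholdValue M ω s rest := by
  induction rest with
  | nil =>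
    intro s i j _ _ _ _ _ hchosen hindep hT hlt hj
    have hTs : T = s.seen := by simpa using hT
    have hlog : Nat.log 2 (rk M (T : Set α)) + 1 = j := by
      rw [hTs]
      rcases hj with rfl | ⟨hj1, hj⟩
      · rw [Nat.log_of_lt (by simpa using hlt)]
      · obtain ⟨k, rfl⟩ : ∃ k, j = k + 1 := ⟨j - 1, by omega⟩
        rw [Nat.log_eq_of_pow_le_of_lt_pow hj hlt]
        rfl
    rw [hlog, show Nat.log 2 (rk M (T : Set α)) + 2 = j + 1 by omega, Finset.Ico_self,
      Finset.sum_empty, add_zero, thresholdValue]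
    gcongr
    simp only [List.not_mem_nil, false_and, Set.ofPred_false, Set.union_empty]
    rw [rk_eq_card hindep, weight, mul_comm, ← nsmul_eq_mul]
    exact Finset.card_nsmul_le_sum _ _ _ fun x hx => by exact_mod_cast (hchosen x hx).le
  | cons x rest ih =>
    intro s i j hs hL hr hw hij hchosen hindep hT hlt hj
    set C := offer M ω (L / 2 ^ i) s.chosen x with hC
    have hCi : M.Indep (C : Set α) := offer_indep hindep
    have hClt : ∀ y ∈ C, L / 2 ^ i < ω y := fun y hy => lt_of_mem_offer hchosen hy
    have hT' : T = insert x s.seen ∪ rest.toFinset := by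
      rw [hT, List.toFinset_cons, Finset.insert_union, Finset.union_insert]
    have hX := rk_union_cons_le_offer (M := M) (ω := ω) (θ := L / 2 ^ i) (x := x) (l := rest) hindep
    have hins : rk M (insert x s.seen : Finset α) ≤ rk M (s.seen : Set α) + 1 := by
      rw [Finset.coe_insert]; exact rk_insert_le _ _
    have hmono : rk M (s.seen : Set α) ≤ rk M (insert x s.seen : Finset α) :=
      rk_mono (by simp)
    have hX' : (rk M ((s.chosen : Set α) ∪ {y | y ∈ x :: rest ∧ L / 2 ^ i < ω y}) : ℝ≥0∞) ≤
        (rk M ((C : Set α) ∪ {y | y ∈ rest ∧ L / 2 ^ i < ω y}) : ℝ≥0∞) :=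
      Nat.cast_le.2 hX
    by_cases hrank : (s.rStar : ℕ∞) ≤ M.eRk (insert x s.seen : Finset α)
    · rw [thresholdValue_cons_of_le hs hrank]
      have hrank' : 2 ^ j ≤ rk M (insert x s.seen : Finset α) := by
        rw [← coe_rk, hr] at hrank
        exact_mod_cast hrank
      have hpos : 1 ≤ j := by rcases hj with rfl | hj <;> [exact le_rfl; exact hj.1]
      have hTj : j + 1 ≤ Nat.log 2 (rk M (T : Set α)) + 1 := by
        have h : 2 ^ j ≤ rk M (T : Set α) :=
          hrank'.trans (rk_mono (by rw [hT', Finset.coe_union]; exact Set.subset_union_left))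
        have := Nat.le_log_of_pow_le (b := 2) one_lt_two h
        omega
      have hlog : Nat.log 2 (2 * s.rStar) = j + 1 := by
        rw [hr, ← pow_succ', Nat.log_pow one_lt_two]
      have hw' : s.bound / (2 * (s.rStar : ℝ≥0)) = L / 2 ^ (j + 1) := by
        rw [hL, hr, pow_succ']
        push_cast
        rfl
      have hrs : 2 * s.rStar = 2 ^ (j + 1) := by rw [hr, pow_succ']
      -- One arrival raises the rank by at most one, so it is now exactly `2 ^ j` and no level is
      -- skipped.
      have hlt' : rk M (insert x s.seen : Finset α) < 2 ^ (j + 1) := by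
        rw [pow_succ]; omega
      have hle : L / 2 ^ (j + 1) ≤ L / 2 ^ i := by
        gcongr
        · exact one_le_two
        · omega
      rw [hlog, hw', hrs, hw, ← hC]
      have ih₁ := ih { s with
        seen := insert x s.seen, chosen := C, rStar := 2 ^ (j + 1), wStar := L / 2 ^ (j + 1) }
        (j + 1) (j + 1) hs hL rfl rfl le_rfl (fun y hy => hle.trans_lt (hClt y hy)) hCi hT' hlt'
        (Or.inr ⟨by omega, hrank'⟩)
      have ih₂ := ih { s with
        seen := insert x s.seen, chosen := C, rStar := 2 ^ (j + 1), wStar := L / 2 ^ i }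
        i (j + 1) hs hL rfl rfl (by omega) hClt hCi hT' hlt' (Or.inr ⟨by omega, hrank'⟩)
      have hmix := le_mul_coin_mixture ih₁ ih₂
      rw [hw] at *
      refine le_trans ?_ hmix
      -- Level `j + 1` leaves the sum of unopened levels and becomes the credit of the switching
      -- branch.
      rw [Finset.sum_eq_sum_Ico_succ_bot (by omega)]
      gcongr
      -- Heavy elements already seen have rank at most `2 ^ j`, which is what was subtracted for
      -- level `j + 1`.
      have hsub : heavy ω L T (j + 1) ⊆ ((insert x s.seen : Finset α) : Set α) ∪
          ((C : Set α) ∪ {y | y ∈ rest ∧ L / 2 ^ (j + 1) < ω y}) := by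
        rintro y ⟨hy, hyl⟩
        rw [hT'] at hy
        rcases Finset.mem_union.1 hy with hy | hy
        · exact Or.inl hy
        · exact Or.inr (Or.inr ⟨List.mem_toFinset.1 hy, hyl⟩)
      have h := (rk_mono (M := M) hsub).trans (rk_union_le _ _)
      rw [add_tsub_cancel_right]
      simp only at *
      omega
    · rw [thresholdValue_cons_of_lt hs hrank]
      have hrank' : rk M (insert x s.seen : Finset α) < 2 ^ j := by
        rw [← coe_rk, hr] at hrank
        exact not_le.1 fun h => hrank (by exact_mod_cast h)
      rw [hw, ← hC]
      refine le_trans ?_ (ih { s with seen := insert x s.seen, chosen := C, wStar := L / 2 ^ i }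
        i j hs hL hr rfl hij hClt hCi hT' hrank' ?_)
      · gcongr
      · rcases hj with hj | hj
        · exact Or.inl hj
        · exact Or.inr ⟨hj.1, hj.2.trans hmono⟩

/-- The initial state of the thresholding algorithm with bound `L` in the given mode. -/
noncomputable def thresholdStart (α : Type u) (L : ℝ≥0) (c : Bool) : ThresholdState α where
  bound := L
  pickOne := c
  seen := ∅
  chosen := ∅
  rStar := 2
  wStar := L / 2

theorem expect_thresholdInit (L : ℝ≥0) (f : ThresholdState α → ℝ≥0∞) :
    expect (thresholdInit α L) f =
      2⁻¹ * (f (thresholdStart α L true) + f (thresholdStart α L false)) := by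
  rw [thresholdInit, expect_bind, expect_coin, expect_pure, expect_pure, mul_add]
  have h : (((1 / 2 : ℝ≥0)) : ℝ≥0∞) = 2⁻¹ := by simp
  rw [h, ENNReal.one_sub_inv_two]
  rfl

/-- The potential bound at the start, `i = j = 1`. Restoring the subtracted `2 ^ (l - 1)` costs at
most `L` on each level. -/
theorem sum_rk_heavy_le [M.RankFinite] (L : ℝ≥0) (B : List α) :
    ∑ l ∈ Finset.Ico 1 (Nat.log 2 (rk M (B.toFinset : Set α)) + 2),
        ((L / 2 ^ l : ℝ≥0) : ℝ≥0∞) * (rk M (heavy ω L B.toFinset l) : ℝ≥0∞) ≤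
      ((Nat.log 2 (rk M (B.toFinset : Set α)) + 1 : ℕ) : ℝ≥0∞) *
        (thresholdValue M ω (thresholdStart α L false) B + L) := by
  have h := le_mul_thresholdValue (M := M) (ω := ω) L B.toFinset B
    (thresholdStart α L false) 1 1 rfl rfl (by simp [thresholdStart]) (by simp [thresholdStart])
    le_rfl (by simp [thresholdStart]) (by simp [thresholdStart]) (by simp [thresholdStart])
    (by simp [thresholdStart, rk_empty]) (Or.inl rfl)
  rw [mul_add]
  have hN : ((Nat.log 2 (rk M (B.toFinset : Set α)) + 1 : ℕ) : ℝ≥0∞) * (L : ℝ≥0∞) =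
      ∑ _l ∈ Finset.Ico 1 (Nat.log 2 (rk M (B.toFinset : Set α)) + 2), (L : ℝ≥0∞) := by
    rw [Finset.sum_const, Nat.card_Ico, nsmul_eq_mul]
    rfl
  refine le_trans ?_ (add_le_add_left h _)
  have hbot (f : ℕ → ℝ≥0∞) : ∑ l ∈ Finset.Ico 1 (Nat.log 2 (rk M (B.toFinset : Set α)) + 2), f l =
      f 1 + ∑ l ∈ Finset.Ico (1 + 1) (Nat.log 2 (rk M (B.toFinset : Set α)) + 2), f l :=
    Finset.sum_eq_sum_Ico_succ_bot (by omega) f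
  rw [hN, hbot, hbot, add_add_add_comm]
  rw [Nat.cast_one, one_mul, thresholdStart, Finset.coe_empty, Set.empty_union]
  gcongr
  · refine le_trans (le_of_eq ?_) (le_self_add)
    congr 3
    ext x
    simp [heavy]
  · rw [← Finset.sum_add_distrib]
    refine Finset.sum_le_sum fun l hl => ?_
    have hL : ((L / 2 ^ l : ℝ≥0) : ℝ≥0∞) * ((2 ^ (l - 1) : ℕ) : ℝ≥0∞) ≤ L := by
      have : L / 2 ^ l * ((2 ^ (l - 1) : ℕ) : ℝ≥0) ≤ L := by
        rw [div_mul_eq_mul_div]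
        refine div_le_of_le_mul₀ (by positivity) (by positivity) ?_
        gcongr
        push_cast
        exact pow_le_pow_right₀ one_le_two (Nat.sub_le _ _)
      exact_mod_cast this
    refine le_trans ?_ (add_le_add_right hL _)
    rw [← mul_add]
    gcongr
    have : rk M (heavy ω L B.toFinset l) ≤
      (rk M (heavy ω L B.toFinset l) - 2 ^ (l - 1)) + 2 ^ (l - 1) := by omega
    exact_mod_cast this

end RandomThreshold

/-! ### An independent set compared with the thresholding value, for fixed weights. -/

section Optimum

open scoped Classical

variable {α : Type u} {M : Matroid α} {ω : α → ℝ≥0}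

/-- When `w` exceeds the next level, its summand doubles the new remainder back to the old one;
otherwise the remainder alone suffices. -/
theorem le_dyadic_sum {w L : ℝ≥0} (h : w ≤ L) (N : ℕ) :
    w ≤ L / 2 ^ N + ∑ l ∈ Finset.Ico 1 (N + 1), if L / 2 ^ l < w then L / 2 ^ l else 0 := by
  induction N with
  | zero => simpa using h
  | succ N ih =>
    by_cases hw : L / 2 ^ (N + 1) < w
    · rw [Finset.sum_Ico_succ_top (by omega), if_pos hw, add_left_comm]
      have : L / 2 ^ (N + 1) + L / 2 ^ (N + 1) = L / 2 ^ N := by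
        rw [← add_div, ← two_mul, pow_succ', mul_div_mul_left _ _ two_ne_zero]
      rwa [this, add_comm _ (L / 2 ^ N)]
    · exact (not_lt.1 hw).trans le_self_add

/-- The total weight of the elements of `B` of weight above `L`. -/
noncomputable def recordWeight (ω : α → ℝ≥0) (L : ℝ≥0) (B : Finset α) : ℝ≥0∞ :=
  ∑ x ∈ B, if L < ω x then (ω x : ℝ≥0∞) else 0

/-- Weights above `L` go to `recordWeight`. For the rest, the dyadic remainders `L / 2 ^ N` sum to
at most `L`, because an independent subset of the block has at most `2 ^ N` elements, and the
members above a level number at most the heavy rank of that level. -/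
theorem weight_inter_le [M.RankFinite] {S : Finset α} (hS : M.Indep (S : Set α)) (L : ℝ≥0)
    (B : List α) :
    weight ω (S ∩ B.toFinset) ≤ recordWeight ω L B.toFinset + L +
      ((Nat.log 2 (rk M (B.toFinset : Set α)) + 1 : ℕ) : ℝ≥0∞) *
        (thresholdValue M ω (thresholdStart α L false) B + L) := by
  set N := Nat.log 2 (rk M (B.toFinset : Set α)) + 1 with hN
  set U := S ∩ B.toFinset with hU
  have hUi : M.Indep (U : Set α) := hS.subset (by simp [hU])
  have hUB : U ⊆ B.toFinset := Finset.inter_subset_right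
  have hpt : ∀ x ∈ U, (ω x : ℝ≥0∞) ≤ (if L < ω x then (ω x : ℝ≥0∞) else 0) +
      (L / 2 ^ N : ℝ≥0) + ∑ l ∈ Finset.Ico 1 (N + 1),
        if L / 2 ^ l < ω x then ((L / 2 ^ l : ℝ≥0) : ℝ≥0∞) else 0 := by
    intro x _
    split_ifs with h
    · rw [add_assoc]
      exact le_self_add
    · rw [zero_add]
      have := le_dyadic_sum (not_lt.1 h) N
      have h' := ENNReal.coe_le_coe.2 this
      push_cast at h'
      refine h'.trans (le_of_eq ?_)
      push_cast
      simp only [apply_ite ENNReal.ofNNReal, ENNReal.coe_zero]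
      norm_num
  have hsmall : ∑ _x ∈ U, ((L / 2 ^ N : ℝ≥0) : ℝ≥0∞) ≤ L := by
    have hcard : U.card ≤ 2 ^ N := by
      rw [← rk_eq_card hUi]
      exact (rk_mono (by exact_mod_cast hUB)).trans (Nat.lt_pow_succ_log_self one_lt_two _).le
    rw [Finset.sum_const, nsmul_eq_mul]
    have : ((U.card : ℕ) : ℝ≥0) * (L / 2 ^ N) ≤ L := by
      have hc : ((U.card : ℕ) : ℝ≥0) ≤ 2 ^ N := by exact_mod_cast hcard
      calc ((U.card : ℕ) : ℝ≥0) * (L / 2 ^ N) ≤ 2 ^ N * (L / 2 ^ N) := by gcongr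
        _ = L := mul_div_cancel₀ _ (by positivity)
    exact_mod_cast this
  have hbig : ∑ x ∈ U, ∑ l ∈ Finset.Ico 1 (N + 1),
        (if L / 2 ^ l < ω x then ((L / 2 ^ l : ℝ≥0) : ℝ≥0∞) else 0) ≤
      (N : ℝ≥0∞) * (thresholdValue M ω (thresholdStart α L false) B + L) := by
    refine le_trans ?_ (sum_rk_heavy_le L B)
    rw [Finset.sum_comm]
    refine Finset.sum_le_sum fun l _ => ?_
    rw [← Finset.sum_filter, Finset.sum_const, nsmul_eq_mul, mul_comm]
    gcongr
    rw [← rk_eq_card (hUi.subset (Finset.coe_subset.2 (Finset.filter_subset _ _)))]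
    refine rk_mono fun x hx => ?_
    rw [Finset.mem_coe, Finset.mem_filter] at hx
    exact ⟨hUB hx.1, hx.2⟩
  calc weight ω U ≤ ∑ x ∈ U, ((if L < ω x then (ω x : ℝ≥0∞) else 0) +
      (L / 2 ^ N : ℝ≥0) + ∑ l ∈ Finset.Ico 1 (N + 1),
        if L / 2 ^ l < ω x then ((L / 2 ^ l : ℝ≥0) : ℝ≥0∞) else 0) := Finset.sum_le_sum hpt
    _ ≤ _ := by
      rw [Finset.sum_add_distrib, Finset.sum_add_distrib]
      gcongr
      exact Finset.sum_le_sum_of_subset hUB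

/-- The non-loop elements which are observed before block number `b`. -/
def blockPrefix (l : List α) (b : ℕ) : List α := l.take (2 ^ b - 1)

/-- The non-loop elements of block number `b`. -/
def blockOf (l : List α) (b : ℕ) : List α := (l.drop (2 ^ b - 1)).take (2 ^ b)

theorem blockPrefix_succ (l : List α) (b : ℕ) :
    blockPrefix l (b + 1) = blockPrefix l b ++ blockOf l b := by
  rw [blockPrefix, blockPrefix, blockOf, ← List.take_add]
  congr 1
  have := Nat.two_pow_pos b
  rw [pow_succ]
  omega

theorem weight_inter_blockPrefix_le (S : Finset α) (l : List α) (b : ℕ) :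
    weight ω (S ∩ (blockPrefix l b).toFinset) ≤
      ∑ c ∈ Finset.range b, weight ω (S ∩ (blockOf l c).toFinset) := by
  induction b with
  | zero => simp [blockPrefix, weight]
  | succ b ih =>
    rw [blockPrefix_succ, List.toFinset_append, Finset.inter_union_distrib_left,
      Finset.sum_range_succ]
    refine le_trans ?_ (add_le_add_left ih _)
    rw [weight, weight, weight, ← Finset.sum_union_inter]
    exact le_self_add

theorem weight_le_sum_blocks (S : Finset α) {l : List α} (hS : S ⊆ l.toFinset) {n : ℕ}
    (hl : l.length ≤ n) :
    weight ω S ≤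
      ∑ b ∈ Finset.range (Nat.log 2 n + 1), weight ω (S ∩ (blockOf l b).toFinset) := by
  refine le_trans (le_of_eq ?_) (weight_inter_blockPrefix_le S l _)
  rw [blockPrefix, List.take_of_length_le, Finset.inter_eq_left.2 hS]
  -- The prefix before block `Nat.log 2 n + 1` has room for `2 ^ (Nat.log 2 n + 1) - 1 ≥ n`
  -- elements, so it is the whole list.
  have := Nat.lt_pow_succ_log_self one_lt_two n
  omega

end Optimum

/-! ### Exchangeability of the random weights. -/

section Average

open scoped Classical

variable {α : Type u} {E : Set α} {W : Finset ℝ≥0}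

theorem averageAssignment_mono {f g : (α → ℝ≥0) → ℝ≥0∞}
    (h : ∀ ω : E ≃ W, f (assign ω) ≤ g (assign ω)) :
    averageAssignment E W f ≤ averageAssignment E W g :=
  ENNReal.div_le_div_right (ENNReal.tsum_le_tsum h) _

theorem averageAssignment_add (f g : (α → ℝ≥0) → ℝ≥0∞) :
    averageAssignment E W (fun ω => f ω + g ω) =
      averageAssignment E W f + averageAssignment E W g := by
  rw [averageAssignment, ENNReal.tsum_add, ENNReal.add_div]
  rfl

theorem averageAssignment_const_mul (c : ℝ≥0∞) (f : (α → ℝ≥0) → ℝ≥0∞) :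
    averageAssignment E W (fun ω => c * f ω) = c * averageAssignment E W f := by
  rw [averageAssignment, ENNReal.tsum_mul_left, mul_div_assoc]
  rfl

theorem averageAssignment_sum {ι : Type*} (s : Finset ι) (f : ι → (α → ℝ≥0) → ℝ≥0∞) :
    averageAssignment E W (fun ω => ∑ i ∈ s, f i ω) =
      ∑ i ∈ s, averageAssignment E W (f i) := by
  induction s using Finset.induction_on with
  | empty => simp [averageAssignment]
  | insert i s hi ih =>
    simp only [Finset.sum_insert hi]
    rw [averageAssignment_add, ih]

/-- Composition with `σ` permutes the bijections; this symmetry drives both averaging estimates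
below. -/
theorem averageAssignment_comp_perm (σ : Equiv.Perm α) (hσ : ∀ x, σ x ∈ E ↔ x ∈ E)
    (f : (α → ℝ≥0) → ℝ≥0∞) :
    averageAssignment E W (fun ω => f (ω ∘ σ)) = averageAssignment E W f := by
  let τ : E ≃ E := σ.subtypePerm hσ
  let e : (E ≃ W) ≃ (E ≃ W) :=
    ⟨fun ω => τ.trans ω, fun ω => τ.symm.trans ω, fun ω => by ext; simp, fun ω => by ext; simp⟩
  have h : ∀ ω : E ≃ W, assign ω ∘ σ = assign (e ω) := by
    intro ω
    funext x
    by_cases hx : x ∈ E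
    · have hx' : σ x ∈ E := (hσ x).2 hx
      simp only [Function.comp_apply, assign, hx, hx', dif_pos]
      rfl
    · have hx' : σ x ∉ E := fun h => hx ((hσ x).1 h)
      simp only [Function.comp_apply, assign, hx, hx', dif_neg, not_false_eq_true]
  rw [averageAssignment, averageAssignment]
  congr 1
  simp only [h]
  exact e.tsum_eq fun ω => f (assign ω)

theorem injOn_assign (ω : E ≃ W) : Set.InjOn (assign ω) E := by
  intro x hx y hy h
  simp only [assign, hx, hy, dif_pos] at h
  simpa using ω.injective (Subtype.ext h)

theorem swap_mem_iff {x y : α} (hx : x ∈ E) (hy : y ∈ E) (z : α) :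
    Equiv.swap x y z ∈ E ↔ z ∈ E := by
  rcases eq_or_ne z x with rfl | hzx
  · simp [hx, hy]
  · rcases eq_or_ne z y with rfl | hzy
    · simp [hx, hy]
    · rw [Equiv.swap_apply_of_ne_of_ne hzx hzy]

/-! ### Elements whose weight exceeds the weights of a prefix -/

/-- Swapping `e` with `a ∈ A` turns the event that `e` beats `A` into one in which `a` beats the
rest of `A`. For different `a` these latter events exclude each other, so the sum over `a` is at
most the maximum of `A`. -/
theorem card_mul_average_record_le {A : Finset α} (hA : (A : Set α) ⊆ E) {e : α} (he : e ∈ E)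
    (heA : e ∉ A) :
    (A.card : ℝ≥0∞) *
        averageAssignment E W (fun ω => if A.sup ω < ω e then (ω e : ℝ≥0∞) else 0) ≤
      averageAssignment E W (fun ω => ((A.sup ω : ℝ≥0) : ℝ≥0∞)) := by
  have hswap : ∀ a ∈ A,
      averageAssignment E W (fun ω => if A.sup ω < ω e then (ω e : ℝ≥0∞) else 0) ≤
        averageAssignment E W
          (fun ω => if ∀ z ∈ A, z ≠ a → ω z < ω a then (ω a : ℝ≥0∞) else 0) := by
    intro a ha
    rw [← averageAssignment_comp_perm (Equiv.swap e a) (swap_mem_iff he (hA ha))]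
    refine averageAssignment_mono fun ω => ?_
    simp only [Function.comp_apply, Equiv.swap_apply_left]
    split_ifs with h₁ h₂
    · exact le_rfl
    · refine absurd (fun z hz hza => ?_) h₂
      have hze : z ≠ e := fun h => heA (h ▸ hz)
      have := Finset.le_sup (f := assign ω ∘ Equiv.swap e a) hz
      rw [Function.comp_apply, Equiv.swap_apply_of_ne_of_ne hze hza] at this
      exact this.trans_lt h₁
    · exact zero_le
    · exact le_rfl
  rw [← nsmul_eq_mul, ← Finset.sum_const]
  refine (Finset.sum_le_sum hswap).trans ?_
  rw [← averageAssignment_sum]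
  refine averageAssignment_mono fun ω => ?_
  by_cases h : ∃ a ∈ A, ∀ z ∈ A, z ≠ a → assign ω z < assign ω a
  · obtain ⟨a, ha, h⟩ := h
    rw [Finset.sum_eq_single_of_mem a ha, if_pos h]
    · exact_mod_cast Finset.le_sup (f := assign ω) ha
    · intro b hb hba
      exact if_neg fun h' => (h b hb hba).not_gt (h' a ha hba.symm)
  · push Not at h
    rw [Finset.sum_eq_zero]
    · exact zero_le
    · intro a ha
      refine if_neg fun h' => ?_
      obtain ⟨z, hz, hza, hle⟩ := h a ha
      exact hle.not_gt (h' z hz hza)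

theorem average_recordWeight_le {A B : Finset α} (hA : (A : Set α) ⊆ E) (hB : (B : Set α) ⊆ E)
    (hAB : Disjoint A B) (hcard : B.card ≤ A.card + 1) (hA0 : A.Nonempty) :
    averageAssignment E W (fun ω => recordWeight ω (A.sup ω) B) ≤
      2 * averageAssignment E W (fun ω => ((A.sup ω : ℝ≥0) : ℝ≥0∞)) := by
  have hpos : 1 ≤ A.card := hA0.card_pos
  have h0 : (A.card : ℝ≥0∞) ≠ 0 := by exact_mod_cast (by omega : A.card ≠ 0)
  rw [← ENNReal.mul_le_mul_iff_right h0 (ENNReal.natCast_ne_top _)]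
  simp only [recordWeight]
  rw [averageAssignment_sum, Finset.mul_sum]
  calc _ ≤ ∑ _e ∈ B, averageAssignment E W (fun ω => ((A.sup ω : ℝ≥0) : ℝ≥0∞)) :=
        Finset.sum_le_sum fun e he =>
          card_mul_average_record_le hA (hB he) (Finset.disjoint_right.1 hAB he)
    _ = (B.card : ℝ≥0∞) * averageAssignment E W (fun ω => ((A.sup ω : ℝ≥0) : ℝ≥0∞)) := by
        rw [Finset.sum_const, nsmul_eq_mul]
    _ ≤ ((A.card * 2 : ℕ) : ℝ≥0∞) * averageAssignment E W (fun ω => ((A.sup ω : ℝ≥0) : ℝ≥0∞)) := by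
        gcongr
        omega
    _ = _ := by push_cast; ring

/-! ### The two largest weights -/

/-- `x` has the largest and `y` the second largest weight in `T`. -/
def IsTopPair (ω : α → ℝ≥0) (T : Finset α) (x y : α) : Prop :=
  ω y < ω x ∧ ∀ z ∈ T, z ≠ x → z ≠ y → ω z < ω y

theorem IsTopPair.lt {ω : α → ℝ≥0} {T : Finset α} {x y z : α} (h : IsTopPair ω T x y)
    (hz : z ∈ T) (hzx : z ≠ x) : ω z < ω x := by
  by_cases hzy : z = y
  · rw [hzy]; exact h.1
  · exact (h.2 z hz hzx hzy).trans h.1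

theorem IsTopPair.unique {ω : α → ℝ≥0} {T : Finset α} {x y x' y' : α} (h : IsTopPair ω T x y)
    (h' : IsTopPair ω T x' y') (hx : x ∈ T) (hy : y ∈ T) (hx' : x' ∈ T) (hy' : y' ∈ T) :
    x' = x ∧ y' = y := by
  have hxx : x' = x := by
    by_contra hne
    exact (h.lt hx' hne).not_gt (h'.lt hx (Ne.symm hne))
  subst hxx
  refine ⟨rfl, ?_⟩
  by_contra hne
  have h₁ : y ≠ x' := fun e => (e ▸ h.1).false
  have h₂ : y' ≠ x' := fun e => (e ▸ h'.1).false
  exact (h.2 y' hy' h₂ hne).not_gt (h'.2 y hy h₁ (Ne.symm hne))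

theorem exists_isTopPair {ω : α → ℝ≥0} {T : Finset α} (hω : Set.InjOn ω T) (hT : 1 < T.card) :
    ∃ x ∈ T, ∃ y ∈ T, y ≠ x ∧ IsTopPair ω T x y ∧ T.sup ω ≤ ω x := by
  have hT0 : T.Nonempty := Finset.card_pos.1 (by omega)
  obtain ⟨x, hx, hxmax⟩ := T.exists_max_image ω hT0
  have hT1 : (T.erase x).Nonempty := Finset.card_pos.1 (by rw [Finset.card_erase_of_mem hx]; omega)
  obtain ⟨y, hy, hymax⟩ := (T.erase x).exists_max_image ω hT1
  obtain ⟨hyx, hyT⟩ := Finset.mem_erase.1 hy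
  refine ⟨x, hx, y, hyT, hyx, ⟨?_, ?_⟩, Finset.sup_le hxmax⟩
  · exact (hxmax y hyT).lt_of_ne fun h => hyx (hω hyT hx h)
  · intro z hz hzx hzy
    exact (hymax z (Finset.mem_erase.2 ⟨hzx, hz⟩)).lt_of_ne fun h => hzy (hω hz hyT h)

/-- The largest weight in `T`, provided that `x` has the largest and `y` the second largest
weight. -/
noncomputable def topPairWeight (T : Finset α) (x y : α) (ω : α → ℝ≥0) : ℝ≥0∞ :=
  if IsTopPair ω T x y then (ω x : ℝ≥0∞) else 0

theorem average_topPairWeight_comp_perm (σ : Equiv.Perm α) (hσ : ∀ z, σ z ∈ E ↔ z ∈ E)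
    {T : Finset α} (hT : ∀ z, σ z ∈ T ↔ z ∈ T) (x y : α) :
    averageAssignment E W (topPairWeight T (σ x) (σ y)) =
      averageAssignment E W (topPairWeight T x y) := by
  rw [← averageAssignment_comp_perm σ hσ (topPairWeight T x y)]
  congr 1
  funext ω
  have : IsTopPair (ω ∘ σ) T x y ↔ IsTopPair ω T (σ x) (σ y) := by
    refine and_congr Iff.rfl ⟨fun h z hz hzx hzy => ?_, fun h z hz hzx hzy => ?_⟩
    · have := h (σ.symm z) ((hT _).1 (by simpa using hz)) (fun e => hzx (by simp [← e]))
        (fun e => hzy (by simp [← e]))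
      simpa using this
    · exact h (σ z) ((hT z).2 hz) (fun e => hzx (σ.injective e)) (fun e => hzy (σ.injective e))
  simp only [topPairWeight, this, Function.comp_apply]

/-- Two transpositions carry `(x, y)` to `(x', y')`: the first moves `x` to `x'`, the second moves
the image of `y` to `y'` and fixes `x'`. -/
theorem average_topPairWeight_eq {T : Finset α} (hTE : (T : Set α) ⊆ E) {x y x' y' : α}
    (hx : x ∈ T) (hy : y ∈ T) (hx' : x' ∈ T) (hy' : y' ∈ T) (hxy : y ≠ x) (hxy' : y' ≠ x') :
    averageAssignment E W (topPairWeight T x' y') =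
      averageAssignment E W (topPairWeight T x y) := by
  have hT₁ := fun z => swap_mem_iff (E := (T : Set α)) hx hx' z
  have hE₁ := fun z => swap_mem_iff (hTE hx) (hTE hx') z
  have hy₁ : Equiv.swap x x' y ∈ T := (hT₁ y).2 hy
  have hT₂ := fun z => swap_mem_iff (E := (T : Set α)) hy₁ hy' z
  have hE₂ := fun z => swap_mem_iff (hTE hy₁) (hTE hy') z
  have hne : x' ≠ Equiv.swap x x' y := by
    intro h
    apply hxy
    have := congrArg (Equiv.swap x x') h
    simpa using this.symm
  have h₁ := average_topPairWeight_comp_perm (W := W) _ hE₁ hT₁ x y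
  have h₂ := average_topPairWeight_comp_perm (W := W) _ hE₂ hT₂ x' (Equiv.swap x x' y)
  rw [Equiv.swap_apply_left] at h₁
  rw [Equiv.swap_apply_left, Equiv.swap_apply_of_ne_of_ne hne hxy'.symm] at h₂
  rw [h₂, h₁]

/-- All ordered pairs of distinct elements contribute equally as top pair, so only their numbers
matter: all pairs in `A ∪ B` against those in `B ×ˢ A`. -/
theorem average_sup_le {A B : Finset α} (hA : (A : Set α) ⊆ E) (hB : (B : Set α) ⊆ E)
    (hAB : Disjoint A B) (hcard : B.card = A.card + 1) (hA0 : A.Nonempty) :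
    averageAssignment E W (fun ω => (((A ∪ B).sup ω : ℝ≥0) : ℝ≥0∞)) ≤
      4 * averageAssignment E W (fun ω => ∑ p ∈ B ×ˢ A, topPairWeight (A ∪ B) p.1 p.2 ω) := by
  have hT : ((A ∪ B : Finset α) : Set α) ⊆ E := by
    rw [Finset.coe_union]; exact Set.union_subset hA hB
  have hcardT : (A ∪ B).card = 2 * A.card + 1 := by
    rw [Finset.card_union_of_disjoint hAB]; omega
  have hpos : 1 ≤ A.card := hA0.card_pos
  obtain ⟨a, ha⟩ := hA0
  obtain ⟨e, he⟩ : B.Nonempty := Finset.card_pos.1 (by omega)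
  have hae : a ≠ e := fun h => Finset.disjoint_left.1 hAB ha (h ▸ he)
  have haT : a ∈ A ∪ B := Finset.mem_union_left _ ha
  have heT : e ∈ A ∪ B := Finset.mem_union_right _ he
  set g := averageAssignment E W (topPairWeight (A ∪ B) e a) with hg
  have hlow : averageAssignment E W (fun ω => ∑ p ∈ B ×ˢ A, topPairWeight (A ∪ B) p.1 p.2 ω) =
      ((B.card * A.card : ℕ) : ℝ≥0∞) * g := by
    rw [averageAssignment_sum, ← Finset.card_product, ← nsmul_eq_mul, ← Finset.sum_const]
    refine Finset.sum_congr rfl fun p hp => ?_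
    obtain ⟨h₁, h₂⟩ := Finset.mem_product.1 hp
    exact average_topPairWeight_eq hT heT haT (Finset.mem_union_right _ h₁)
      (Finset.mem_union_left _ h₂) hae fun h => Finset.disjoint_left.1 hAB h₂ (h ▸ h₁)
  have hup : averageAssignment E W (fun ω => (((A ∪ B).sup ω : ℝ≥0) : ℝ≥0∞)) ≤
      (((A ∪ B).card * (A ∪ B).card - (A ∪ B).card : ℕ) : ℝ≥0∞) * g := by
    rw [← Finset.offDiag_card, ← nsmul_eq_mul, ← Finset.sum_const]
    refine le_trans (averageAssignment_mono (g := fun ω =>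
      ∑ p ∈ (A ∪ B).offDiag, topPairWeight (A ∪ B) p.1 p.2 ω) fun ω => ?_) (le_of_eq ?_)
    · obtain ⟨x, hx, y, hy, hyx, hp, hsup⟩ :=
        exists_isTopPair ((injOn_assign ω).mono hT) (by omega)
      refine le_trans ?_ (Finset.single_le_sum (fun _ _ => zero_le)
        (Finset.mem_offDiag.2 ⟨hx, hy, hyx.symm⟩ : (x, y) ∈ (A ∪ B).offDiag))
      rw [topPairWeight, if_pos hp]
      exact_mod_cast hsup
    · rw [averageAssignment_sum]
      refine Finset.sum_congr rfl fun p hp => ?_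
      obtain ⟨h₁, h₂, h₃⟩ := Finset.mem_offDiag.1 hp
      exact average_topPairWeight_eq hT heT haT h₁ h₂ hae h₃.symm
  rw [hlow, ← mul_assoc]
  refine hup.trans ?_
  gcongr
  -- With `m = A.card` this is `2m(2m + 1) ≤ 4m(m + 1)`.
  have : (A ∪ B).card * (A ∪ B).card - (A ∪ B).card ≤ 4 * (B.card * A.card) := by
    rw [hcardT, hcard, Nat.sub_le_iff_le_add]
    nlinarith
  exact_mod_cast this

end Average

/-! ### Charging the optimum to the blocks. -/

section Blocks

open scoped Classical

variable {α : Type u} {M : Matroid α}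

/-- At most one pair is the top pair. If its maximum is in `B` and its runner-up in `A`, the maximum
is the only block element above the bound, so it is picked. -/
theorem sum_topPairWeight_le_thresholdValue {ω : α → ℝ≥0} {A B : List α}
    (hB : ∀ x ∈ B, M.IsNonloop x) (hAB : Disjoint A.toFinset B.toFinset) :
    ∑ p ∈ B.toFinset ×ˢ A.toFinset, topPairWeight (A.toFinset ∪ B.toFinset) p.1 p.2 ω ≤
      thresholdValue M ω (thresholdStart α (A.toFinset.sup ω) true) B := by
  set T := A.toFinset ∪ B.toFinset with hT
  by_cases h : ∃ p ∈ B.toFinset ×ˢ A.toFinset, IsTopPair ω T p.1 p.2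
  · obtain ⟨⟨x, y⟩, hp, h⟩ := h
    obtain ⟨hx, hy⟩ := Finset.mem_product.1 hp
    simp only at hx hy h
    have hxT : x ∈ T := Finset.mem_union_right _ hx
    have hyT : y ∈ T := Finset.mem_union_left _ hy
    have hxA : x ∉ A.toFinset := Finset.disjoint_right.1 hAB hx
    rw [Finset.sum_eq_single_of_mem _ hp]
    · rw [topPairWeight, if_pos h]
      refine le_thresholdValue_pickOne B _ rfl rfl hB (List.mem_toFinset.1 hx) ?_ ?_
      · refine (Finset.sup_lt_iff (bot_le.trans_lt h.1)).2 fun z hz => ?_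
        exact h.lt (Finset.mem_union_left _ hz) fun e => hxA (e ▸ hz)
      · intro z hz hzx
        have hz' := List.mem_toFinset.2 hz
        have hzy : z ≠ y := fun e => Finset.disjoint_left.1 hAB hy (e ▸ hz')
        exact (h.2 z (Finset.mem_union_right _ hz') hzx hzy).le.trans
          (Finset.le_sup (f := ω) hy)
    · rintro ⟨x', y'⟩ hq hne
      obtain ⟨hx', hy'⟩ := Finset.mem_product.1 hq
      refine if_neg fun h' => hne ?_
      obtain ⟨e₁, e₂⟩ := h.unique h' hxT hyT (Finset.mem_union_right _ hx')
        (Finset.mem_union_left _ hy')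
      exact Prod.ext e₁ e₂
  · push Not at h
    exact (Finset.sum_eq_zero fun p hp => if_neg (h p hp)).trans_le zero_le

/-- The expected weight selected by the thresholding algorithm on block number `b`. -/
noncomputable def blockValue (M : Matroid α) (l : List α) (b : ℕ) (ω : α → ℝ≥0) : ℝ≥0∞ :=
  2⁻¹ * (thresholdValue M ω (thresholdStart α ((blockPrefix l b).toFinset.sup ω) true)
      (blockOf l b) +
    thresholdValue M ω (thresholdStart α ((blockPrefix l b).toFinset.sup ω) false) (blockOf l b))

theorem expect_output (M : Matroid α) (ω : α → ℝ≥0) (order : List α) :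
    expect ((blockAlgorithm α).output M ω order) (weight ω) =
      ((Nat.log 2 order.length + 1 : ℕ) : ℝ≥0∞)⁻¹ *
        ∑ b ∈ Finset.range (Nat.log 2 order.length + 1),
          blockValue M (order.filter (M.IsNonloop ·)) b ω := by
  rw [output_blockAlgorithm, expect_bind, expect_uniformOfFintype, Fintype.card_fin,
    Finset.sum_range]
  congr 1
  refine Finset.sum_congr rfl fun b _ => ?_
  rw [expect_run_observe M ω b order ∅ 0 0 (Nat.zero_le _), expect_thresholdInit, tsub_zero]
  have h : ∀ L : ℝ≥0, 0 ⊔ L = L := fun L => max_eq_right zero_le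
  rw [h]
  rfl

theorem pickOne_add_threshold_eq (M : Matroid α) (l : List α) (b : ℕ) (ω : α → ℝ≥0) :
    thresholdValue M ω (thresholdStart α ((blockPrefix l b).toFinset.sup ω) true) (blockOf l b) +
      thresholdValue M ω (thresholdStart α ((blockPrefix l b).toFinset.sup ω) false)
        (blockOf l b) = 2 * blockValue M l b ω := by
  rw [blockValue, ← mul_assoc, ENNReal.mul_inv_cancel two_ne_zero ENNReal.ofNat_ne_top, one_mul]

variable {l : List α} {W : Finset ℝ≥0}

theorem disjoint_blockPrefix_blockOf (hl : l.Nodup) (b : ℕ) :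
    Disjoint (blockPrefix l b).toFinset (blockOf l b).toFinset := by
  rw [List.disjoint_toFinset_iff_disjoint]
  have h : (blockPrefix l b ++ blockOf l b).Nodup := by
    rw [← blockPrefix_succ]
    exact hl.sublist (List.take_sublist _ _)
  exact List.disjoint_of_nodup_append h

theorem blockPrefix_subset (l : List α) (b : ℕ) : blockPrefix l b ⊆ l := List.take_subset _ _

theorem blockOf_subset (l : List α) (b : ℕ) : blockOf l b ⊆ l :=
  fun _ h => List.drop_subset _ _ (List.take_subset _ _ h)

theorem card_blockPrefix (hl : l.Nodup) (b : ℕ) :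
    (blockPrefix l b).toFinset.card = min (2 ^ b - 1) l.length := by
  rw [blockPrefix, List.toFinset_card_of_nodup (hl.sublist (List.take_sublist _ _)),
    List.length_take]

theorem card_blockOf (hl : l.Nodup) (b : ℕ) :
    (blockOf l b).toFinset.card = min (2 ^ b) (l.length - (2 ^ b - 1)) := by
  rw [blockOf, List.toFinset_card_of_nodup (hl.sublist ((List.take_sublist _ _).trans
    (List.drop_sublist _ _))), List.length_take, List.length_drop]

/-- The length condition makes block `b` full, one element larger than its prefix. The constant is
`4` from the top pairs times `2` from the mode coin. -/
theorem average_sup_blockPrefix_le (hl : l.Nodup) (hM : ∀ x ∈ l, M.IsNonloop x) {b : ℕ}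
    (hb : 2 ^ (b + 1) - 1 ≤ l.length) :
    averageAssignment M.E W
        (fun ω => (((blockPrefix l (b + 1)).toFinset.sup ω : ℝ≥0) : ℝ≥0∞)) ≤
      8 * averageAssignment M.E W (blockValue M l b) := by
  have hpow := Nat.two_pow_pos b
  have hpow' : 2 ^ (b + 1) = 2 * 2 ^ b := pow_succ' _ _
  have hE : ∀ x ∈ l, x ∈ M.E := fun x hx => (hM x hx).mem_ground
  have hAE : ((blockPrefix l b).toFinset : Set α) ⊆ M.E := fun x hx =>
    hE x (blockPrefix_subset l b (List.mem_toFinset.1 hx))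
  have hBE : ((blockOf l b).toFinset : Set α) ⊆ M.E := fun x hx =>
    hE x (blockOf_subset l b (List.mem_toFinset.1 hx))
  have hdisj := disjoint_blockPrefix_blockOf hl b
  have hBM : ∀ x ∈ blockOf l b, M.IsNonloop x := fun x hx => hM x (blockOf_subset l b hx)
  have hcA := card_blockPrefix hl b
  have hcB := card_blockOf hl b
  have hpick : averageAssignment M.E W (fun ω => thresholdValue M ω
      (thresholdStart α ((blockPrefix l b).toFinset.sup ω) true) (blockOf l b)) ≤
      2 * averageAssignment M.E W (blockValue M l b) := by
    rw [← averageAssignment_const_mul]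
    refine averageAssignment_mono fun ω => ?_
    rw [← pickOne_add_threshold_eq]
    exact le_self_add
  have hmain : averageAssignment M.E W
        (fun ω => (((blockPrefix l (b + 1)).toFinset.sup ω : ℝ≥0) : ℝ≥0∞)) ≤
      4 * averageAssignment M.E W (fun ω => thresholdValue M ω
        (thresholdStart α ((blockPrefix l b).toFinset.sup ω) true) (blockOf l b)) := by
    rw [blockPrefix_succ, List.toFinset_append]
    rcases (blockPrefix l b).toFinset.eq_empty_or_nonempty with hA | hA
    -- Block `0`: the bound is `0`, and the only element is picked as soon as its weight is
    -- positive.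
    · rw [hA] at hcA ⊢
      obtain ⟨e, he⟩ : ∃ e, blockOf l b = [e] := by
        rw [← List.length_eq_one_iff, blockOf, List.length_take, List.length_drop]
        rw [Finset.card_empty] at hcA
        omega
      rw [← averageAssignment_const_mul]
      refine averageAssignment_mono fun ω => ?_
      rw [he]
      simp only [List.toFinset_cons, List.toFinset_nil, insert_empty_eq, Finset.empty_union,
        Finset.sup_singleton, Finset.sup_empty]
      by_cases h0 : assign ω e = 0
      · simp [h0]
      · calc ((assign ω e : ℝ≥0) : ℝ≥0∞) ≤
              thresholdValue M (assign ω) (thresholdStart α ⊥ true) [e] := by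
              refine le_thresholdValue_pickOne [e] _ rfl rfl ?_ (by simp) ?_ (by simp)
              · rw [← he]; exact hBM
              · exact pos_iff_ne_zero.2 h0
          _ ≤ _ := le_mul_of_one_le_left zero_le (by norm_num)
    · refine (average_sup_le hAE hBE hdisj (by omega) hA).trans ?_
      gcongr
      exact averageAssignment_mono fun ω => sum_topPairWeight_le_thresholdValue hBM hdisj
  calc _ ≤ _ := hmain
    _ ≤ 4 * (2 * averageAssignment M.E W (blockValue M l b)) := by gcongr
    _ = _ := by rw [← mul_assoc]; norm_num

/-- Write `Λ` for the mean bound. Records cost `2 * Λ`, so the total is at most `κ * (T + 4 * Λ)`;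
`Λ` is at most `8` times the value of the previous block, whence `32`. -/
theorem average_block_le [M.RankFinite] (hl : l.Nodup) (hM : ∀ x ∈ l, M.IsNonloop x) {r : ℕ}
    (hr : M.eRank = r) (b : ℕ) :
    averageAssignment M.E W (fun ω => ⨆ S : {S : Finset α // M.Indep (S : Set α)},
        weight ω (S.1 ∩ (blockOf l b).toFinset)) ≤
      ((Nat.log 2 r + 1 : ℕ) : ℝ≥0∞) * (2 * averageAssignment M.E W (blockValue M l b) +
        32 * if b = 0 then 0 else averageAssignment M.E W (blockValue M l (b - 1))) := by
  set κ : ℝ≥0∞ := ((Nat.log 2 r + 1 : ℕ) : ℝ≥0∞) with hκ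
  have hκ1 : 1 ≤ κ := by rw [hκ]; exact_mod_cast Nat.le_add_left 1 _
  by_cases hB : blockOf l b = []
  · refine le_trans (le_of_eq ?_) zero_le
    simp [hB, weight, averageAssignment]
  have hpos : 0 < (blockOf l b).toFinset.card :=
    Finset.card_pos.2 (List.toFinset_nonempty_iff _ |>.2 hB)
  have hcA := card_blockPrefix hl b
  have hcB := card_blockOf hl b
  have hpow := Nat.two_pow_pos b
  have hE : ∀ x ∈ l, x ∈ M.E := fun x hx => (hM x hx).mem_ground
  have hAE : ((blockPrefix l b).toFinset : Set α) ⊆ M.E := fun x hx =>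
    hE x (blockPrefix_subset l b (List.mem_toFinset.1 hx))
  have hBE : ((blockOf l b).toFinset : Set α) ⊆ M.E := fun x hx =>
    hE x (blockOf_subset l b (List.mem_toFinset.1 hx))
  have hdisj := disjoint_blockPrefix_blockOf hl b
  have hBM : ∀ x ∈ blockOf l b, M.IsNonloop x := fun x hx => hM x (blockOf_subset l b hx)
  have hrk : rk M ((blockOf l b).toFinset : Set α) ≤ r := by
    have := M.eRk_le_eRank ((blockOf l b).toFinset : Set α)
    rw [← coe_rk, hr] at this
    exact_mod_cast this
  set R := averageAssignment M.E W
    (fun ω => recordWeight ω ((blockPrefix l b).toFinset.sup ω) (blockOf l b).toFinset) with hR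
  set Λ := averageAssignment M.E W
    (fun ω => (((blockPrefix l b).toFinset.sup ω : ℝ≥0) : ℝ≥0∞)) with hΛ
  set P := averageAssignment M.E W (fun ω => thresholdValue M ω
    (thresholdStart α ((blockPrefix l b).toFinset.sup ω) true) (blockOf l b)) with hP
  set T := averageAssignment M.E W (fun ω => thresholdValue M ω
    (thresholdStart α ((blockPrefix l b).toFinset.sup ω) false) (blockOf l b)) with hT
  have hPT : P + T = 2 * averageAssignment M.E W (blockValue M l b) := by
    rw [hP, hT, ← averageAssignment_add, ← averageAssignment_const_mul]
    simp only [pickOne_add_threshold_eq]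
  have hopt : averageAssignment M.E W (fun ω => ⨆ S : {S : Finset α // M.Indep (S : Set α)},
      weight ω (S.1 ∩ (blockOf l b).toFinset)) ≤ R + Λ + κ * (T + Λ) := by
    rw [hR, hΛ, hT, ← averageAssignment_add, ← averageAssignment_add,
      ← averageAssignment_const_mul, ← averageAssignment_add]
    refine averageAssignment_mono fun ω => iSup_le fun S => ?_
    refine (weight_inter_le S.2 ((blockPrefix l b).toFinset.sup (assign ω)) _).trans ?_
    gcongr
    rw [hκ]
    have := Nat.log_mono_right (b := 2) hrk
    exact_mod_cast Nat.succ_le_succ this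
  refine hopt.trans ?_
  -- Block `0` has no predecessor, but there `Λ = 0` and the single-element mode pays for the
  -- record.
  rcases Nat.eq_zero_or_pos b with rfl | hb
  · have hA : blockPrefix l 0 = [] := by simp [blockPrefix]
    have hΛ0 : Λ = 0 := by simp [hΛ, hA, averageAssignment]
    obtain ⟨e, he⟩ : ∃ e, blockOf l 0 = [e] := by
      rw [← List.length_eq_one_iff]
      have h1 := List.length_pos_iff.2 hB
      have h2 : (blockOf l 0).length ≤ 1 := by simp [blockOf]
      omega
    have hRP : R ≤ P := by
      refine averageAssignment_mono fun ω => ?_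
      rw [hA, he]
      simp only [recordWeight, List.toFinset_cons, List.toFinset_nil, insert_empty_eq,
        Finset.sum_singleton, Finset.sup_empty]
      split_ifs with h
      · refine le_thresholdValue_pickOne [e] _ rfl rfl ?_ (by simp) h (by simp)
        rw [← he]; exact hBM
      · exact zero_le
    rw [hΛ0, if_pos rfl, mul_zero, add_zero, add_zero, add_zero, ← hPT, mul_add]
    gcongr
    exact hRP.trans (le_mul_of_one_le_left zero_le hκ1)
  · obtain ⟨c, rfl⟩ : ∃ c, b = c + 1 := ⟨b - 1, by omega⟩
    have hpow' : 2 ^ (c + 1) = 2 * 2 ^ c := pow_succ' _ _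
    have hpow'' := Nat.two_pow_pos c
    -- Block `c + 1` is nonempty, so its prefix has full length `2 ^ (c + 1) - 1`.
    have hAne : (blockPrefix l (c + 1)).toFinset.Nonempty := Finset.card_pos.1 (by omega)
    have hR2 : R ≤ 2 * Λ := average_recordWeight_le hAE hBE hdisj (by omega) hAne
    have hΛ8 : Λ ≤ 8 * averageAssignment M.E W (blockValue M l c) :=
      average_sup_blockPrefix_le hl hM (by omega)
    rw [if_neg (by omega), add_tsub_cancel_right, ← hPT]
    calc R + Λ + κ * (T + Λ) ≤ 2 * Λ + Λ + κ * (T + Λ) := by gcongr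
      _ = 3 * Λ + κ * (T + Λ) := by ring
      _ ≤ κ * (3 * Λ) + κ * (T + Λ) := by
        exact add_le_add_left (le_mul_of_one_le_left zero_le hκ1) _
      _ = κ * (T + 4 * Λ) := by ring
      _ ≤ κ * ((P + T) + 4 * (8 * averageAssignment M.E W (blockValue M l c))) := by
        gcongr
        exact le_add_self
      _ = _ := by ring

/-- Each block is charged `2` on its own account and at most `32` as predecessor of the next, giving
`34`; the number of blocks enters through the uniform choice of `b`. -/
theorem average_optWeight_le [M.RankFinite] {order : List α} (ho : order.Nodup)
    (hE : ∀ x, x ∈ order ↔ x ∈ M.E) {r : ℕ} (hr : M.eRank = r) :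
    averageAssignment M.E W (fun ω => optWeight M ω) ≤
      34 * ((Nat.log 2 r + 1 : ℕ) : ℝ≥0∞) * ((Nat.log 2 order.length + 1 : ℕ) : ℝ≥0∞) *
        averageAssignment M.E W (fun ω =>
          expect ((blockAlgorithm α).output M ω order) (weight ω)) := by
  set l := order.filter (M.IsNonloop ·) with hl
  have hlM : ∀ x ∈ l, M.IsNonloop x := fun x hx => by simpa using (List.mem_filter.1 hx).2
  have hln : l.Nodup := ho.filter _
  set K := Nat.log 2 order.length + 1 with hK
  set κ : ℝ≥0∞ := ((Nat.log 2 r + 1 : ℕ) : ℝ≥0∞) with hκ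
  set V : ℕ → ℝ≥0∞ := fun b => averageAssignment M.E W (blockValue M l b) with hV
  have hK0 : (K : ℝ≥0∞) ≠ 0 := by exact_mod_cast (by omega : K ≠ 0)
  have hout : (K : ℝ≥0∞) * averageAssignment M.E W (fun ω =>
      expect ((blockAlgorithm α).output M ω order) (weight ω)) = ∑ b ∈ Finset.range K, V b := by
    simp only [expect_output]
    rw [averageAssignment_const_mul, ← mul_assoc,
      ENNReal.mul_inv_cancel hK0 (ENNReal.natCast_ne_top _), one_mul, averageAssignment_sum]
  have hopt : averageAssignment M.E W (fun ω => optWeight M ω) ≤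
      ∑ b ∈ Finset.range K, averageAssignment M.E W
        (fun ω => ⨆ S : {S : Finset α // M.Indep (S : Set α)},
          weight ω (S.1 ∩ (blockOf l b).toFinset)) := by
    rw [← averageAssignment_sum]
    refine averageAssignment_mono fun ω => iSup_le fun S => ?_
    have hS : S.1 ⊆ l.toFinset := by
      intro x hx
      have := S.2.isNonloop_of_mem (Finset.mem_coe.2 hx)
      simp [hl, hE, this, this.mem_ground]
    refine (weight_le_sum_blocks S.1 hS (List.length_filter_le _ _)).trans ?_
    exact Finset.sum_le_sum fun b _ =>
      le_iSup (fun S : {S : Finset α // M.Indep (S : Set α)} =>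
        weight (assign ω) (S.1 ∩ (blockOf l b).toFinset)) S
  have hshift : ∑ b ∈ Finset.range K, (if b = 0 then 0 else V (b - 1)) ≤
      ∑ b ∈ Finset.range K, V b := by
    rw [hK, Finset.sum_range_succ', Finset.sum_range_succ]
    simp
  rw [mul_assoc, hout]
  calc _ ≤ _ := hopt
    _ ≤ ∑ b ∈ Finset.range K, κ * (2 * V b + 32 * if b = 0 then 0 else V (b - 1)) :=
      Finset.sum_le_sum fun b _ => average_block_le hln hlM hr b
    _ = κ * (2 * ∑ b ∈ Finset.range K, V b +
        32 * ∑ b ∈ Finset.range K, if b = 0 then 0 else V (b - 1)) := by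
      rw [← Finset.mul_sum, Finset.sum_add_distrib, Finset.mul_sum, Finset.mul_sum]
    _ ≤ κ * (2 * ∑ b ∈ Finset.range K, V b + 32 * ∑ b ∈ Finset.range K, V b) := by gcongr
    _ = _ := by ring

theorem natLog_add_one_le_logb {n : ℕ} (hn : n ≠ 0) :
    ((Nat.log 2 n + 1 : ℕ) : ℝ) ≤ Real.logb 2 (2 * (n : ℝ)) := by
  have hn' : (0 : ℝ) < n := by exact_mod_cast Nat.pos_of_ne_zero hn
  rw [Real.le_logb_iff_rpow_le one_lt_two (by positivity), Real.rpow_natCast, pow_succ']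
  have := Nat.pow_log_le_self 2 hn
  gcongr
  exact_mod_cast this

end Blocks

end MatroidSecretary

theorem mainTheorem4 :
    ∃ C : ℝ, 0 < C ∧
      ∀ (α : Type u) (M : Matroid α) (r : ℕ) (_ : M.eRank = (r : ℕ∞))
        (order : List α) (_ : order.Nodup) (_ : ∀ x, x ∈ order ↔ x ∈ M.E)
        (W : Finset ℝ≥0) (_ : W.card = order.length),
        (∀ ω : M.E ≃ W,
          ∀ S ∈ ((MatroidSecretary.blockAlgorithm α).output M
              (MatroidSecretary.assign ω) order).support, M.Indep (S : Set α)) ∧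
        MatroidSecretary.averageAssignment M.E W
            (fun ω => MatroidSecretary.optWeight M ω) ≤
          ENNReal.ofReal (C * Real.logb 2 (2 * (r : ℝ)) * Real.logb 2 (2 * (order.length : ℝ))) *
            MatroidSecretary.averageAssignment M.E W (fun ω =>
              MatroidSecretary.expect ((MatroidSecretary.blockAlgorithm α).output M ω order)
                (MatroidSecretary.weight ω)) := by
  refine ⟨34, by norm_num, fun α M r hr order ho hE W _ => ⟨fun ω S hS =>
    MatroidSecretary.indep_of_mem_support_output M _ order S hS, ?_⟩⟩
  have hfin : M.RankFinite := (M.eRank_ne_top_iff).1 (by rw [hr]; exact ENat.natCast_ne_top r)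
  rcases Nat.eq_zero_or_pos r with rfl | hr0
  -- In rank `0` only `∅` is independent, so the left side vanishes and the value of the logarithm
  -- at `0` is irrelevant.
  · refine le_trans (le_of_eq ?_) zero_le
    have hopt : ∀ ω : α → ℝ≥0, MatroidSecretary.optWeight M ω = 0 := by
      intro ω
      refine le_antisymm (iSup_le fun S => ?_) zero_le
      have h := S.2.encard_le_eRank
      rw [hr, Nat.cast_zero, nonpos_iff_eq_zero, Set.encard_eq_zero, Finset.coe_eq_empty] at h
      simp [MatroidSecretary.weight, h]
    simp [hopt, MatroidSecretary.averageAssignment]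
  · have hn0 : order.length ≠ 0 := by
      intro h
      rw [List.length_eq_zero_iff] at h
      have hE0 : M.E = ∅ := Set.eq_empty_of_forall_notMem fun x hx => by
        have := (hE x).2 hx
        simp [h] at this
      have := M.eRank_le_encard_ground
      rw [hr, hE0, Set.encard_empty] at this
      have : r ≤ 0 := by exact_mod_cast this
      omega
    refine (MatroidSecretary.average_optWeight_le ho hE hr).trans ?_
    gcongr
    have h₁ := MatroidSecretary.natLog_add_one_le_logb hr0.ne'
    have h₂ := MatroidSecretary.natLog_add_one_le_logb hn0
    have e : (34 : ℝ≥0∞) * ((Nat.log 2 r + 1 : ℕ) : ℝ≥0∞) *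
        ((Nat.log 2 order.length + 1 : ℕ) : ℝ≥0∞) =
        ENNReal.ofReal (34 * ((Nat.log 2 r + 1 : ℕ) : ℝ) *
          ((Nat.log 2 order.length + 1 : ℕ) : ℝ)) := by
      rw [ENNReal.ofReal_mul (by positivity), ENNReal.ofReal_mul (by positivity),
        ENNReal.ofReal_natCast, ENNReal.ofReal_natCast, ENNReal.ofReal_ofNat]
    rw [e]
    refine ENNReal.ofReal_le_ofReal ?_
    gcongr
    exact mul_nonneg (by norm_num) ((Nat.cast_nonneg _).trans h₁)
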